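/- Let $\mathcal{C}$ be an exact category in the sense of Quillen, i.e. an additive category with a class of kernel–cokernel pairs, the conflations $0\to X\xrightarrow{i} Y\xrightarrow{p} Z\to 0$, satisfying the usual axioms; such $i$ are called inflations, such $p$ deflations. Let $\mathrm{Ext}^1_{\mathcal C}(X,Y)$ be the Yoneda Ext, the equivalence classes of conflations $0\to Y\to Z\to X\to 0$. For a class $\mathcal{X}$ of objects put $\mathcal{X}^{\perp_1}=\{Y\mid \mathrm{Ext}^1_{\mathcal C}(X,Y)=0\ \forall X\in\mathcal{X}\}$ and ${}^{\perp_1}\mathcal{X}=\{Y\mid \mathrm{Ext}^1_{\mathcal C}(Y,X)=0\ \forall X\in\mathcal{X}\}$. For an ordinal $\lambda$, a $\lambda$-sequence is a direct system $(X_\alpha)_{\alpha<\lambda}$ such that $X_\gamma=\operatorname{colim}_{\alpha<\gamma}X_\alpha$ for each limit ordinal $\gamma<\lambda$; if its colimit exists, the morphism $X_0\to\operatorname{colim}_{\alpha<\lambda}X_\alpha$ is its composition, called a transfinite composition of the morphisms $X_\alpha\to X_{\alpha+1}$. An object $X$ is small relative to the inflations if there is an infinite regular cardinal $\kappa$ such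 that $\mathrm{Hom}_{\mathcal C}(X,-)$ preserves the colimit, whenever it exists, of every $\lambda$-sequence of inflations with $\operatorname{cf}\lambda\ge\kappa$. For a set $\mathcal{I}$ of inflations, $\mathrm{Coker}(\mathcal{I})$ is the class of objects isomorphic to cokernels of members of $\mathcal{I}$; $\mathcal{I}$ is strongly homological if for every conflation $0\to A\xrightarrow{j} B\to S\to 0$ with $S\in\mathrm{Coker}(\mathcal{I})$ there are a conflation $0\to A'\xrightarrow{i} B'\to S\to 0$ with $i\in\mathcal{I}$ and a morphism from it to the given conflation which is the identity on $S$. The exact category $\mathcal{C}$ is efficient if: (Ax1) arbitrary transfinite compositions of inflations exist and are inflations; (Ax2) every object is small relative to the class of all inflations; (Ax3) for every set $\mathcal{S}$ of objects there is a strongly homological set $\mathcal{I}$ of inflations such that $\mathrm{Coker}(\mathcal{I})$ is the class of objects isomorphic to objects of $\mathcal{S}$. An object $X$ is $\mathcal{S}$-filtered, written $X\in\mathrm{Filt}\,\mathcal{S}$, if $0\to X$ is the composition of a $\lambda$-sequence in which all $X_\alpha\to X_{\alpha+1}$ are inflations with cokernel isomorphic to an object of $\mathcal{S}$. A class $\mathcal{F}$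 is precovering if for every object $M$ there is $f\colon F\to M$ with $F\in\mathcal{F}$ through which every morphism $F'\to M$ with $F'\in\mathcal{F}$ factors; preenveloping is the dual notion. A pair $(\mathcal{X},\mathcal{Y})$ is a cotorsion pair if $\mathcal{X}^{\perp_1}=\mathcal{Y}$ and $\mathcal{X}={}^{\perp_1}\mathcal{Y}$; it is complete if for every object $M$ there are conflations $0\to Y\to X\to M\to 0$ and $0\to M\to Y'\to X'\to 0$ with $X,X'\in\mathcal{X}$ and $Y,Y'\in\mathcal{Y}$. A set $\mathcal{S}$ of objects is generating if every object $M$ admits a deflation $G\to M$ with $G$ a set-indexed coproduct of objects of $\mathcal{S}$. An object $P$ is projective if every deflation onto $P$ splits, and $\mathcal{C}$ has enough projectives if every object admits a deflation from a projective object. **Theorem.** Let $\mathcal{C}$ be an efficient exact category, let $\mathcal{S}$ be a set of objects of $\mathcal{C}$ and put $\mathcal{T}=\mathcal{S}^{\perp_1}$. Then: 1. $\mathrm{Filt}\,\mathcal{S}$ is a precovering class and $\mathcal{T}$ is a preenveloping class. 2. If $\mathcal{S}$ is a generating set of $\mathcal{C}$, then $({}^{\perp_1}\mathcal{T},\mathcal{T})$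 is a complete cotorsion pair in $\mathcal{C}$, and ${}^{\perp_1}\mathcal{T}$ consists precisely of the direct summands of $\mathcal{S}$-filtered objects. 3. If $\mathcal{C}$ has enough projectives, then $({}^{\perp_1}\mathcal{T},\mathcal{T})$ is a complete cotorsion pair in $\mathcal{C}$, and an object $M$ is in ${}^{\perp_1}\mathcal{T}$ if and only if it is a direct summand of an object $E$ appearing in a conflation $0\to P\to E\to X\to 0$ with $P$ projective and $X\in\mathrm{Filt}\,\mathcal{S}$. -/

import Mathlib

open CategoryTheory CategoryTheory.Limits

universe v u

namespace ExactCat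

section Basic

variable {C : Type u} [Category.{v} C] [Preadditive C]

/-- The first morphisms of the short complexes in the class `P`. -/
def inflationsOf (P : ObjectProperty (ShortComplex C)) : MorphismProperty C :=
  fun _ Y f => ∃ (Z : C) (g : Y ⟶ Z) (w : f ≫ g = 0), P (ShortComplex.mk f g w)

/-- The second morphisms of the short complexes in the class `P`. -/
def deflationsOf (P : ObjectProperty (ShortComplex C)) : MorphismProperty C :=
  fun Y _ g => ∃ (X : C) (f : X ⟶ Y) (w : f ≫ g = 0), P (ShortComplex.mk f g w)

end Basic

/-- `X` is `κ`-small relative to the class of morphisms `W`: for every well-ordered continuous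
chain `F` of morphisms of `W` of length of cofinality at least `κ`, the functor `Hom(X, -)`
preserves the colimit of `F`, whenever that colimit exists. -/
def IsSmallRelative {C : Type u} [Category.{v} C] (κ : Cardinal.{v}) (W : MorphismProperty C)
    (X : C) : Prop :=
  ∀ (J : Type v) [LinearOrder J] [SuccOrder J] [OrderBot J] [WellFoundedLT J]
    (F : J ⥤ C) [F.IsWellOrderContinuous], κ ≤ Order.cof J →
    (∀ j : J, ¬ IsMax j → W (F.map (homOfLE (Order.le_succ j)))) →
    PreservesColimit F (coyoneda.obj (Opposite.op X))

/-- An exact structure, in the sense of Quillen, on an additive category `C`: a class of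
kernel-cokernel pairs (the conflations), closed under isomorphism, subject to the usual
self-dual list of axioms. -/
structure ExactStructure (C : Type u) [Category.{v} C] [Preadditive C] [HasZeroObject C]
    [HasBinaryBiproducts C] where
  /-- the class of conflations `X₁ ↣ X₂ ↠ X₃` -/
  conflation : ObjectProperty (ShortComplex C)
  isKernel : ∀ K : ShortComplex C, conflation K → Nonempty (IsLimit (KernelFork.ofι K.f K.zero))
  isCokernel : ∀ K : ShortComplex C, conflation K →
    Nonempty (IsColimit (CokernelCofork.ofπ K.g K.zero))
  of_iso : ∀ K L : ShortComplex C, Nonempty (K ≅ L) → conflation K → conflation L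
  id_inflation : ∀ X : C, inflationsOf conflation (𝟙 X)
  id_deflation : ∀ X : C, deflationsOf conflation (𝟙 X)
  comp_inflation : ∀ ⦃X Y Z : C⦄ (f : X ⟶ Y) (g : Y ⟶ Z),
    inflationsOf conflation f → inflationsOf conflation g → inflationsOf conflation (f ≫ g)
  comp_deflation : ∀ ⦃X Y Z : C⦄ (f : X ⟶ Y) (g : Y ⟶ Z),
    deflationsOf conflation f → deflationsOf conflation g → deflationsOf conflation (f ≫ g)
  /-- pushouts of inflations along arbitrary morphisms exist and are inflations -/
  pushout_inflation : ∀ ⦃A B X : C⦄ (i : A ⟶ B) (t : A ⟶ X), inflationsOf conflation i →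
    ∃ (Y : C) (j : X ⟶ Y) (b : B ⟶ Y), IsPushout t i j b ∧ inflationsOf conflation j
  /-- pullbacks of deflations along arbitrary morphisms exist and are deflations -/
  pullback_deflation : ∀ ⦃B D Z : C⦄ (p : B ⟶ D) (t : Z ⟶ D), deflationsOf conflation p →
    ∃ (Y : C) (q : Y ⟶ Z) (b : Y ⟶ B), IsPullback b q p t ∧ deflationsOf conflation q

namespace ExactStructure

variable {C : Type u} [Category.{v} C] [Preadditive C] [HasZeroObject C]
  [HasBinaryBiproducts C] (E : ExactStructure C)

/-- The class of inflations. -/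
def inflations : MorphismProperty C := inflationsOf E.conflation

/-- The class of deflations. -/
def deflations : MorphismProperty C := deflationsOf E.conflation

/-- `E.IsConflation f g` : the sequence `0 ⟶ X ⟶ Y ⟶ Z ⟶ 0` given by `f` and `g` is a
conflation. -/
def IsConflation {X Y Z : C} (f : X ⟶ Y) (g : Y ⟶ Z) : Prop :=
  ∃ w : f ≫ g = 0, E.conflation (ShortComplex.mk f g w)

/-! ### Yoneda `Ext¹` -/

/-- A conflation `0 ⟶ Y ⟶ Z ⟶ X ⟶ 0` with prescribed ends. -/
structure Extension (X Y : C) where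
  /-- the middle term -/
  obj : C
  /-- the inflation -/
  i : Y ⟶ obj
  /-- the deflation -/
  p : obj ⟶ X
  isConflation : E.IsConflation i p

/-- Equivalence of extensions: an isomorphism of conflations that is the identity on both ends. -/
def extensionSetoid (X Y : C) : Setoid (E.Extension X Y) where
  r a b := ∃ e : a.obj ≅ b.obj, a.i ≫ e.hom = b.i ∧ e.hom ≫ b.p = a.p
  iseqv :=
    { refl := fun a => ⟨Iso.refl _, by simp, by simp⟩
      symm := by
        rintro a b ⟨e, h₁, h₂⟩
        exact ⟨e.symm, by simp [← h₁], by simp [← h₂]⟩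
      trans := by
        rintro a b c ⟨e, h₁, h₂⟩ ⟨e', h₁', h₂'⟩
        exact ⟨e ≪≫ e', by simp [reassoc_of% h₁, h₁'], by simp [h₂', h₂]⟩ }

/-- The equivalence classes of conflations `0 ⟶ Y ⟶ Z ⟶ X ⟶ 0`. -/
def Ext1 (X Y : C) : Type (max u v) := Quotient (E.extensionSetoid X Y)

/-- `Ext¹(X, Y) = 0`: there is only one class of extensions (the class of the split one). -/
def Ext1Vanishes (X Y : C) : Prop := Subsingleton (E.Ext1 X Y)

/-- The class `S^{⊥₁}`. -/
def rightOrth (S : ObjectProperty C) : ObjectProperty C :=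
  fun Y => ∀ X : C, S X → E.Ext1Vanishes X Y

/-- The class `^{⊥₁}S`. -/
def leftOrth (S : ObjectProperty C) : ObjectProperty C :=
  fun X => ∀ Y : C, S Y → E.Ext1Vanishes X Y

/-! ### Cotorsion pairs, projectives, generators -/

/-- `(𝒳, 𝒴)` is a cotorsion pair. -/
def IsCotorsionPair (𝒳 𝒴 : ObjectProperty C) : Prop :=
  E.rightOrth 𝒳 = 𝒴 ∧ 𝒳 = E.leftOrth 𝒴

/-- `(𝒳, 𝒴)` is a complete cotorsion pair: every object `M` admits approximation sequences
`0 ⟶ Y ⟶ X ⟶ M ⟶ 0` and `0 ⟶ M ⟶ Y' ⟶ X' ⟶ 0`. -/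
def IsCompleteCotorsionPair (𝒳 𝒴 : ObjectProperty C) : Prop :=
  E.IsCotorsionPair 𝒳 𝒴 ∧ ∀ M : C,
    (∃ (Y X : C) (i : Y ⟶ X) (p : X ⟶ M), 𝒴 Y ∧ 𝒳 X ∧ E.IsConflation i p) ∧
    (∃ (Y' X' : C) (i : M ⟶ Y') (p : Y' ⟶ X'), 𝒴 Y' ∧ 𝒳 X' ∧ E.IsConflation i p)

/-- `P` is projective: every deflation onto `P` splits. -/
def IsProjective (P : C) : Prop :=
  ∀ ⦃Y : C⦄ (p : Y ⟶ P), E.deflations p → ∃ s : P ⟶ Y, s ≫ p = 𝟙 P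

/-- Every object is the target of a deflation from a projective object. -/
def HasEnoughProjectives : Prop :=
  ∀ X : C, ∃ (P : C) (p : P ⟶ X), E.IsProjective P ∧ E.deflations p

/-- `G` is generating: every object is the target of a deflation from a (set-indexed) coproduct
of objects of `G`. -/
def IsGenerating (G : ObjectProperty C) : Prop :=
  ∀ M : C, ∃ (ι : Type v) (X : ι → C) (c : Cofan X) (_ : IsColimit c) (p : c.pt ⟶ M),
    (∀ i, G (X i)) ∧ E.deflations p

/-! ### Filtrations -/

/-- The inflations whose cokernel is (isomorphic to an object) in `S`. -/
def inflationsWithCokernelIn (S : ObjectProperty C) : MorphismProperty C :=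
  fun _ B f => ∃ (X : C) (p : B ⟶ X), S X ∧ E.IsConflation f p

open ZeroObject in
/-- `Filt S`: the objects `X` such that `0 ⟶ X` is the composition of a well-ordered continuous
chain of inflations with cokernels in `S`. -/
def filt (S : ObjectProperty C) : ObjectProperty C :=
  fun X => (E.inflationsWithCokernelIn S).transfiniteCompositions.{v} (0 : (0 : C) ⟶ X)

/-! ### Efficient exact categories -/

/-- `Coker I`: the objects isomorphic to the cokernel of a member of the class of inflations `I`. -/
def coker (I : MorphismProperty C) : ObjectProperty C :=
  fun X => ∃ (A B : C) (i : A ⟶ B) (p : B ⟶ X), I i ∧ E.IsConflation i p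

/-- A class `I` of inflations is strongly homological if for every conflation
`0 ⟶ A ⟶ B ⟶ X ⟶ 0` with `X` in `Coker I` there is `i : A' ⟶ B'` in `I`, the inflation of a
conflation `0 ⟶ A' ⟶ B' ⟶ X ⟶ 0`, and a morphism from the latter conflation to the former which
is the identity on `X`. -/
def IsStronglyHomological (I : MorphismProperty C) : Prop :=
  ∀ ⦃A B X : C⦄ (j : A ⟶ B) (q : B ⟶ X), E.coker I X → E.IsConflation j q →
    ∃ (A' B' : C) (i : A' ⟶ B') (p : B' ⟶ X) (a : A' ⟶ A) (b : B' ⟶ B),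
      I i ∧ E.IsConflation i p ∧ i ≫ b = a ≫ j ∧ b ≫ q = p

/-- An efficient exact category. -/
structure IsEfficient : Prop where
  /-- transfinite compositions of inflations exist ... -/
  hasColimit : ∀ (J : Type v) [LinearOrder J] [SuccOrder J] [OrderBot J] [WellFoundedLT J]
    (F : J ⥤ C) [F.IsWellOrderContinuous],
    (∀ j : J, ¬ IsMax j → E.inflations (F.map (homOfLE (Order.le_succ j)))) → HasColimit F
  /-- ... and are inflations -/
  transfinite : E.inflations.IsStableUnderTransfiniteComposition.{v}
  /-- every object is small relative to the class of inflations -/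
  small : ∀ X : C, ∃ κ : Cardinal.{v}, κ.IsRegular ∧ IsSmallRelative κ E.inflations X
  /-- every set `S` of objects is, up to isomorphism, `Coker I` for a strongly homological set
  of inflations `I` -/
  stronglyHomological : ∀ S : ObjectProperty C, ObjectProperty.Small.{v} S →
    ∃ I : MorphismProperty C, MorphismProperty.IsSmall.{v} I ∧ I ≤ E.inflations ∧
      E.IsStronglyHomological I ∧ E.coker I = S.isoClosure

end ExactStructure

/-! ### Approximations -/

section Approximations

variable {C : Type u} [Category.{v} C]

/-- `f : X ⟶ M` is an `F`-precover. -/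
def IsPrecover (F : ObjectProperty C) {X M : C} (f : X ⟶ M) : Prop :=
  F X ∧ ∀ ⦃X' : C⦄ (f' : X' ⟶ M), F X' → ∃ h : X' ⟶ X, h ≫ f = f'

/-- `f : M ⟶ X` is an `F`-preenvelope. -/
def IsPreenvelope (F : ObjectProperty C) {M X : C} (f : M ⟶ X) : Prop :=
  F X ∧ ∀ ⦃X' : C⦄ (f' : M ⟶ X'), F X' → ∃ h : X ⟶ X', f ≫ h = f'

/-- Every object has an `F`-precover. -/
def IsPrecovering (F : ObjectProperty C) : Prop :=
  ∀ M : C, ∃ (X : C) (f : X ⟶ M), IsPrecover F f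

/-- Every object has an `F`-preenvelope. -/
def IsPreenveloping (F : ObjectProperty C) : Prop :=
  ∀ M : C, ∃ (X : C) (f : M ⟶ X), IsPreenvelope F f

/-- `M` is a direct summand of `X`. -/
def IsSummand [Preadditive C] [HasBinaryBiproducts C] (M X : C) : Prop :=
  ∃ N : C, Nonempty (M ⊞ N ≅ X)

end Approximations

end ExactCat

/-! The theorem is the small object argument for inflations with cokernel in `S`, combined with the
reading of `Ext¹`-orthogonality as a lifting property. If `Ext¹(X, T) = 0`, an inflation with
cokernel `X` lifts against a deflation with kernel `T` (`Ext1Vanishes.hasLiftingProperty`). Classes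
defined by left lifting are closed under transfinite composition, so `S`-filtered objects lie in
`^{⊥₁}(S^{⊥₁})` (`filt_le_leftOrth`).

A morphism of conflations that is the identity on the last term is a pushout square
(`IsConflation.isPushout`). With (Ax3) this makes every inflation with cokernel in `S` a pushout of
a member of a fixed small family (`exists_generating_family`). Attaching this family along all
commutative squares, and iterating up to a regular cardinal large enough for the smallness of the
domains, factors any morphism as `j ≫ p`, where `j` is a transfinite composition of inflations with
cokernel in `S` and `p` has the right lifting property against all such compositions
(`exists_factorization_llp`).

For `0 ⟶ M` the factorization gives a `Filt S`-precover; for `M ⟶ 0` it gives a conflation `M ⟶ T ⟶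
X` with `T` in `S^{⊥₁}` and `X` filtered, hence the preenvelope. Pushing out the embedding so
obtained for the kernel of a deflation `G ⟶ M` gives a deflation `P ⟶ M` with kernel in `S^{⊥₁}`,
where `P` is an extension of a filtered object by `G` (Salce's trick). With `G` a coproduct of
objects of `S`, or projective, `P` lies in `^{⊥₁}(S^{⊥₁})`, which yields completeness; if `M` lies
there too, the conflation splits and `M` is a summand of `P`.

The category need not be cocomplete: only pushouts and chains of inflations are available. Hence
cells are attached one at a time (`exists_isMultiPushout`), the iteration is carried out in a
cocomplete enlargement (`exists_iteration`), and nested transfinite compositions are flattened,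
using that inflations are monomorphisms (`transfiniteCompositions_of_transfiniteCompositions`). -/

namespace ExactCat.ExactStructure

variable {C : Type u} [Category.{v} C] [Preadditive C] [HasZeroObject C]
  [HasBinaryBiproducts C] {E : ExactStructure C}

/-! ### Elementary calculus of conflations -/

namespace IsConflation

variable {X Y Z : C} {i : X ⟶ Y} {p : Y ⟶ Z}

lemma w (h : E.IsConflation i p) : i ≫ p = 0 := h.1

lemma exists_lift (h : E.IsConflation i p) {T : C} (k : T ⟶ Y) (hk : k ≫ p = 0) :
    ∃ l : T ⟶ X, l ≫ i = k := by
  obtain ⟨hl⟩ := E.isKernel _ h.2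
  exact ⟨_, (KernelFork.IsLimit.lift' hl k hk).2⟩

lemma exists_desc (h : E.IsConflation i p) {T : C} (k : Y ⟶ T) (hk : i ≫ k = 0) :
    ∃ l : Z ⟶ T, p ≫ l = k := by
  obtain ⟨hl⟩ := E.isCokernel _ h.2
  exact ⟨_, (CokernelCofork.IsColimit.desc' hl k hk).2⟩

lemma mono (h : E.IsConflation i p) : Mono i := by
  obtain ⟨hl⟩ := E.isKernel _ h.2
  exact mono_of_isLimit_fork hl

lemma epi (h : E.IsConflation i p) : Epi p := by
  obtain ⟨hl⟩ := E.isCokernel _ h.2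
  exact epi_of_isColimit_cofork hl

lemma inflation (h : E.IsConflation i p) : E.inflations i := ⟨_, _, _, h.2⟩

lemma deflation (h : E.IsConflation i p) : E.deflations p := ⟨_, _, _, h.2⟩

lemma of_iso (h : E.IsConflation i p) {X' Y' Z' : C} {i' : X' ⟶ Y'} {p' : Y' ⟶ Z'}
    (e₁ : X ≅ X') (e₂ : Y ≅ Y') (e₃ : Z ≅ Z') (h₁ : i ≫ e₂.hom = e₁.hom ≫ i')
    (h₂ : p ≫ e₃.hom = e₂.hom ≫ p') : E.IsConflation i' p' := by
  have w' : i' ≫ p' = 0 := by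
    rw [← cancel_epi e₁.hom, ← Category.assoc, ← h₁, Category.assoc, ← h₂, reassoc_of% h.w]
    simp
  exact ⟨w', E.of_iso _ _ ⟨ShortComplex.isoMk e₁ e₂ e₃ h₁.symm h₂.symm⟩ h.2⟩

end IsConflation

lemma exists_isConflation_of_inflation {X Y : C} {i : X ⟶ Y} (h : E.inflations i) :
    ∃ (Z : C) (p : Y ⟶ Z), E.IsConflation i p := by
  obtain ⟨Z, p, w, h⟩ := h
  exact ⟨Z, p, w, h⟩

lemma exists_isConflation_of_deflation {Y Z : C} {p : Y ⟶ Z} (h : E.deflations p) :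
    ∃ (X : C) (i : X ⟶ Y), E.IsConflation i p := by
  obtain ⟨X, i, w, h⟩ := h
  exact ⟨X, i, w, h⟩

lemma mono_of_inflation {X Y : C} {i : X ⟶ Y} (h : E.inflations i) : Mono i := by
  obtain ⟨Z, p, h⟩ := exists_isConflation_of_inflation h
  exact h.mono

/-- An inflation together with a cokernel is a conflation. -/
lemma isConflation_of_inflation {X Y Z : C} {i : X ⟶ Y} {p : Y ⟶ Z} (hi : E.inflations i)
    (w : i ≫ p = 0) [Epi p]
    (hp : ∀ {T : C} (k : Y ⟶ T), i ≫ k = 0 → ∃ l, p ≫ l = k) : E.IsConflation i p := by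
  obtain ⟨Z', p', h⟩ := exists_isConflation_of_inflation hi
  have := h.epi
  obtain ⟨a, ha⟩ := h.exists_desc p w
  obtain ⟨b, hb⟩ := hp p' h.w
  refine h.of_iso (Iso.refl _) (Iso.refl _) ⟨a, b, ?_, ?_⟩ (by simp) (by simpa using ha)
  · rw [← cancel_epi p', reassoc_of% ha, hb, Category.comp_id]
  · rw [← cancel_epi p, reassoc_of% hb, ha, Category.comp_id]

/-- A deflation together with a kernel is a conflation. -/
lemma isConflation_of_deflation {X Y Z : C} {i : X ⟶ Y} {p : Y ⟶ Z} (hp : E.deflations p)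
    (w : i ≫ p = 0) [Mono i]
    (hi : ∀ {T : C} (k : T ⟶ Y), k ≫ p = 0 → ∃ l, l ≫ i = k) : E.IsConflation i p := by
  obtain ⟨X', i', h⟩ := exists_isConflation_of_deflation hp
  have := h.mono
  obtain ⟨a, ha⟩ := h.exists_lift i w
  obtain ⟨b, hb⟩ := hi i' h.w
  refine h.of_iso ⟨b, a, ?_, ?_⟩ (Iso.refl _) (Iso.refl _) (by simpa using hb.symm) (by simp)
  · rw [← cancel_mono i', Category.assoc, ha, hb, Category.id_comp]
  · rw [← cancel_mono i, Category.assoc, hb, ha, Category.id_comp]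

instance : E.inflations.RespectsIso :=
  MorphismProperty.RespectsIso.of_respects_arrow_iso _ (by
    rintro f g e h
    obtain ⟨Z, p, h⟩ := exists_isConflation_of_inflation h
    exact (h.of_iso (p' := e.inv.right ≫ p) (Arrow.leftFunc.mapIso e)
      (Arrow.rightFunc.mapIso e) (Iso.refl _) (Arrow.w e.hom).symm
      ((Category.comp_id p).trans (Arrow.hom_inv_id_right_assoc e p).symm)).inflation)

instance : E.deflations.RespectsIso :=
  MorphismProperty.RespectsIso.of_respects_arrow_iso _ (by
    rintro f g e h
    obtain ⟨Z, p, h⟩ := exists_isConflation_of_deflation h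
    exact (h.of_iso (i' := p ≫ e.hom.left) (Iso.refl _) (Arrow.leftFunc.mapIso e)
      (Arrow.rightFunc.mapIso e) (by simp; rfl) (Arrow.w e.hom).symm).deflation)

instance : E.inflations.IsStableUnderCobaseChange where
  of_isPushout {A B A' B' i t j b} sq hi := by
    obtain ⟨Y, j', b', sq', hj'⟩ := E.pushout_inflation _ t hi
    let e : Y ≅ B' := sq'.isoIsPushout _ _ sq
    have he : j' ≫ e.hom = j := by simp [e]
    exact he ▸ MorphismProperty.RespectsIso.postcomp _ e.hom _ hj'

instance : E.deflations.IsStableUnderBaseChange where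
  of_isPullback {X Y Z S f g f' g'} sq hg := by
    obtain ⟨P, q, b, sq', hq⟩ := E.pullback_deflation _ f hg
    exact (E.deflations.arrow_mk_iso_iff (Arrow.isoMk
      (IsPullback.isoIsPullback _ _ sq' sq) (Iso.refl _) (by simp))).1 hq

lemma hasPushout_of_inflation {A B X : C} (i : A ⟶ B) (t : A ⟶ X) (hi : E.inflations i) :
    HasPushout t i := by
  obtain ⟨_, _, _, sq, _⟩ := E.pushout_inflation i t hi
  exact sq.hasPushout

/-- The pushout of a conflation along a morphism out of its first object. -/
lemma IsConflation.exists_of_isPushout {A B S A' B' : C} {i : A ⟶ B} {p : B ⟶ S}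
    (h : E.IsConflation i p) {a : A ⟶ A'} {i' : A' ⟶ B'} {b : B ⟶ B'}
    (sq : IsPushout a i i' b) : ∃ p' : B' ⟶ S, b ≫ p' = p ∧ E.IsConflation i' p' := by
  have := h.epi
  refine ⟨sq.desc 0 p (by simp [h.w]), by simp, ?_⟩
  have hp : b ≫ sq.desc 0 p (by simp [h.w]) = p := by simp
  have : Epi (sq.desc 0 p (by simp [h.w])) := epi_of_epi_fac hp
  refine isConflation_of_inflation (MorphismProperty.of_isPushout sq h.inflation) (by simp) ?_
  intro T k hk
  obtain ⟨l, hl⟩ := h.exists_desc (b ≫ k) (by rw [← reassoc_of% sq.w, hk, comp_zero])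
  refine ⟨l, sq.hom_ext (by simp [hk]) (by simp [hl])⟩

/-- The pullback of a conflation along a morphism into its last object. -/
lemma IsConflation.exists_of_isPullback {K B S B' S' : C} {i : K ⟶ B} {p : B ⟶ S}
    (h : E.IsConflation i p) {s : S' ⟶ S} {p' : B' ⟶ S'} {b : B' ⟶ B}
    (sq : IsPullback b p' p s) : ∃ i' : K ⟶ B', i' ≫ b = i ∧ E.IsConflation i' p' := by
  have := h.mono
  refine ⟨sq.lift i 0 (by simp [h.w]), by simp, ?_⟩
  have hi : sq.lift i 0 (by simp [h.w]) ≫ b = i := by simp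
  have : Mono (sq.lift i 0 (by simp [h.w])) := mono_of_mono_fac hi
  refine isConflation_of_deflation (MorphismProperty.of_isPullback sq h.deflation) (by simp) ?_
  intro T k hk
  obtain ⟨l, hl⟩ := h.exists_lift (k ≫ b) (by rw [Category.assoc, sq.w, reassoc_of% hk, zero_comp])
  refine ⟨l, sq.hom_ext (by simp [hl]) (by simp [hk])⟩

/-- A morphism of conflations which is the identity on the last objects is a pushout square. -/
lemma IsConflation.isPushout {A B S A' B' : C} {i : A ⟶ B} {p : B ⟶ S} {i' : A' ⟶ B'}
    {p' : B' ⟶ S} (h : E.IsConflation i p) (h' : E.IsConflation i' p') {a : A ⟶ A'} {b : B ⟶ B'}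
    (hab : i ≫ b = a ≫ i') (hb : b ≫ p' = p) : IsPushout a i i' b := by
  -- The pullback `Q` of `p'` and `p` carries two conflations, `A ⟶ Q ⟶ B'` and `A' ⟶ Q ⟶ B`. The
  -- second is split by `s = (b, 𝟙)`, so `Q` is `A' ⊞ B`. The first then exhibits `B'` as the
  -- cokernel of `i ≫ s - a ≫ j'`, that is, of `(-a, i) : A ⟶ A' ⊞ B`, which is the pushout.
  obtain ⟨Q, q, r, sq, hq⟩ := E.pullback_deflation p' p h'.deflation
  obtain ⟨j, hj, hjq⟩ := h.exists_of_isPullback sq.flip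
  obtain ⟨j', hj', hjq'⟩ := h'.exists_of_isPullback sq
  have := hjq.epi
  have := h.mono
  have := h'.mono
  have hjq0 := hjq.w
  have hjq0' := hjq'.w
  let s : B ⟶ Q := sq.lift b (𝟙 _) (by simp [hb])
  have hs₁ : s ≫ r = b := by simp [s]
  have hs₂ : s ≫ q = 𝟙 _ := by simp [s]
  have hj_eq : j = i ≫ s - a ≫ j' := by
    apply sq.hom_ext
    · simp [hs₁, hjq0, hab, hj']
    · simp [hs₂, hjq0', hj]
  have desc : ∀ {T : C} (x : A' ⟶ T) (y : B ⟶ T), a ≫ x = i ≫ y →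
      ∃ l : B' ⟶ T, i' ≫ l = x ∧ b ≫ l = y := by
    intro T x y hxy
    have hQ : ∀ {V : C} (k : V ⟶ Q), ∃ t, t ≫ j' = k - k ≫ q ≫ s := fun k =>
      hjq'.exists_lift _ (by simp [hs₂])
    -- `t` is the projection of `Q` onto `A'` along `s`, so `t ≫ x + q ≫ y` is the morphism out of
    -- `Q` with components `x` and `y`.
    obtain ⟨t, ht⟩ := hQ (𝟙 Q)
    simp only [Category.id_comp] at ht
    have := hjq'.mono
    have htj : j' ≫ t = 𝟙 _ := by
      rw [← cancel_mono j']; simp [ht, reassoc_of% hjq0']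
    have hts : s ≫ t = 0 := by
      rw [← cancel_mono j']; simp [ht, reassoc_of% hs₂]
    obtain ⟨l, hl⟩ := hjq.exists_desc (t ≫ x + q ≫ y) (by
      simp only [Preadditive.comp_add]
      rw [reassoc_of% hj]
      simp [hj_eq, hxy, reassoc_of% hts, reassoc_of% htj])
    refine ⟨l, ?_, ?_⟩
    · rw [← hj', Category.assoc, hl]
      simp [reassoc_of% htj, reassoc_of% hjq0']
    · rw [← hs₁, Category.assoc, hl]
      simp [reassoc_of% hts, reassoc_of% hs₂]
  have uniq : ∀ {T : C} (l l' : B' ⟶ T), i' ≫ l = i' ≫ l' → b ≫ l = b ≫ l' → l = l' := by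
    intro T l l' h₁ h₂
    have : r ≫ l = r ≫ l' := by
      obtain ⟨t, ht⟩ := hjq'.exists_lift (𝟙 Q - q ≫ s) (by simp [hs₂])
      have hid : 𝟙 Q = t ≫ j' + q ≫ s := by rw [ht]; abel
      rw [← Category.id_comp r, hid]
      simp [hj', hs₁, h₁, h₂]
    rwa [cancel_epi] at this
  refine ⟨⟨hab.symm⟩, ⟨PushoutCocone.IsColimit.mk _
    (fun s => (desc s.inl s.inr s.condition).choose)
    (fun s => (desc s.inl s.inr s.condition).choose_spec.1)
    (fun s => (desc s.inl s.inr s.condition).choose_spec.2) ?_⟩⟩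
  intro s m h₁ h₂
  refine uniq _ _ ?_ ?_
  · rw [h₁, (desc s.inl s.inr s.condition).choose_spec.1]
  · rw [h₂, (desc s.inl s.inr s.condition).choose_spec.2]

end ExactCat.ExactStructure

/-! ### `Ext¹`-vanishing as a lifting property -/

namespace ExactCat.ExactStructure

variable {C : Type u} [Category.{v} C] [Preadditive C] [HasZeroObject C]
  [HasBinaryBiproducts C] {E : ExactStructure C}

open ZeroObject

lemma isConflation_zero_id (X : C) : E.IsConflation (0 : (0 : C) ⟶ X) (𝟙 X) := by
  have : Mono (0 : (0 : C) ⟶ X) := ⟨fun _ _ _ => (isZero_zero C).eq_of_tgt _ _⟩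
  exact isConflation_of_deflation (E.id_deflation X) (by simp)
    (fun k hk => ⟨0, by simpa using hk.symm⟩)

lemma isConflation_inl_snd (Y X : C) :
    E.IsConflation (biprod.inl : Y ⟶ Y ⊞ X) (biprod.snd : Y ⊞ X ⟶ X) := by
  obtain ⟨p, hp, h⟩ := (isConflation_zero_id (E := E) X).exists_of_isPushout
    (IsPushout.of_has_biproduct Y X)
  obtain rfl : p = biprod.snd := biprod.hom_ext' _ _ (by simp [h.w]) (by simp [hp])
  exact h

namespace IsConflation

variable {X Y Z : C} {i : X ⟶ Y} {p : Y ⟶ Z}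

lemma exists_section (h : E.IsConflation i p) {r : Y ⟶ X} (hr : i ≫ r = 𝟙 X) :
    ∃ s : Z ⟶ Y, s ≫ p = 𝟙 Z ∧ p ≫ s = 𝟙 Y - r ≫ i := by
  have := h.epi
  have hw := h.w
  obtain ⟨s, hs⟩ := h.exists_desc (𝟙 Y - r ≫ i) (by simp [reassoc_of% hr])
  refine ⟨s, ?_, hs⟩
  rw [← cancel_epi p, reassoc_of% hs]
  simp [hw]

lemma exists_retraction (h : E.IsConflation i p) {s : Z ⟶ Y} (hs : s ≫ p = 𝟙 Z) :
    ∃ r : Y ⟶ X, i ≫ r = 𝟙 X ∧ r ≫ i = 𝟙 Y - p ≫ s := by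
  have := h.mono
  have hw := h.w
  obtain ⟨r, hr⟩ := h.exists_lift (𝟙 Y - p ≫ s) (by simp [hs])
  refine ⟨r, ?_, hr⟩
  rw [← cancel_mono i, Category.assoc, hr]
  simp [reassoc_of% hw]

/-- If a conflation splits, its middle term is the biproduct of the outer terms. -/
lemma isSummand_of_section (h : E.IsConflation i p) {s : Z ⟶ Y} (hs : s ≫ p = 𝟙 Z) :
    IsSummand Z Y := by
  obtain ⟨r, hr, hr'⟩ := h.exists_retraction hs
  have hw := h.w
  have := h.mono
  have hsr : s ≫ r = 0 := by
    rw [← cancel_mono i, Category.assoc, hr']; simp [reassoc_of% hs]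
  refine ⟨X, ⟨⟨biprod.desc s i, biprod.lift p r, ?_, ?_⟩⟩⟩
  · ext <;> simp [hs, hr, hw, hsr]
  · simp [hr']

lemma isIso_middle {Y' : C} {i' : X ⟶ Y'} {p' : Y' ⟶ Z} (h : E.IsConflation i p)
    (h' : E.IsConflation i' p') {b : Y ⟶ Y'} (hi : i ≫ b = i') (hp : b ≫ p' = p) : IsIso b :=
  (h.isPushout h' (a := 𝟙 X) (b := b) (by simpa using hi) hp).isIso_inr_of_isIso

end IsConflation

/-- Comparison with the biproduct extension gives the retraction. Conversely, a retraction of one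
extension and a section of another assemble into a morphism between them that is the identity on
both ends, hence an isomorphism by `isIso_middle`. -/
lemma ext1Vanishes_iff (X Y : C) : E.Ext1Vanishes X Y ↔
    ∀ ⦃Z : C⦄ (i : Y ⟶ Z) (p : Z ⟶ X), E.IsConflation i p → ∃ r : Z ⟶ Y, i ≫ r = 𝟙 Y := by
  constructor
  · intro h Z i p hip
    obtain ⟨e, he, -⟩ := Quotient.exact (s := E.extensionSetoid X Y) (h.elim
      (Quotient.mk _ ⟨Z, i, p, hip⟩) (Quotient.mk _ ⟨_, _, _, isConflation_inl_snd Y X⟩))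
    exact ⟨e.hom ≫ biprod.fst, by rw [reassoc_of% he]; simp⟩
  · intro h
    refine ⟨fun a b => ?_⟩
    obtain ⟨a, rfl⟩ := a.exists_rep
    obtain ⟨b, rfl⟩ := b.exists_rep
    refine Quotient.sound ?_
    obtain ⟨r, hr⟩ := h _ _ a.isConflation
    obtain ⟨r', hr'⟩ := h _ _ b.isConflation
    obtain ⟨s', hs', -⟩ := b.isConflation.exists_section hr'
    have ha := a.isConflation.w
    have hb := b.isConflation.w
    let f : a.obj ⟶ b.obj := r ≫ b.i + a.p ≫ s'
    have h₁ : a.i ≫ f = b.i := by simp [f, reassoc_of% hr, reassoc_of% ha]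
    have h₂ : f ≫ b.p = a.p := by simp [f, hb, hs']
    have := a.isConflation.isIso_middle b.isConflation h₁ h₂
    exact ⟨asIso f, h₁, h₂⟩

/-- The pushout of the conflation along `f` is an extension of `S` by `Y`, hence splits; its
retraction turns the pushout leg into the extension of `f`. -/
lemma Ext1Vanishes.exists_extension {A B S Y : C} (hY : E.Ext1Vanishes S Y) {i : A ⟶ B}
    {p : B ⟶ S} (h : E.IsConflation i p) (f : A ⟶ Y) : ∃ g : B ⟶ Y, i ≫ g = f := by
  obtain ⟨Q, j, b, sq, hj⟩ := E.pushout_inflation i f h.inflation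
  obtain ⟨q, hq, hjq⟩ := h.exists_of_isPushout sq
  obtain ⟨r, hr⟩ := (ext1Vanishes_iff _ _).1 hY _ _ hjq
  exact ⟨b ≫ r, by rw [← reassoc_of% sq.w, hr, Category.comp_id]⟩

lemma Ext1Vanishes.exists_section {X Y Z : C} (h : E.Ext1Vanishes X Y) {i : Y ⟶ Z} {p : Z ⟶ X}
    (hip : E.IsConflation i p) : ∃ s : X ⟶ Z, s ≫ p = 𝟙 X := by
  obtain ⟨r, hr⟩ := (ext1Vanishes_iff _ _).1 h _ _ hip
  obtain ⟨s, hs, -⟩ := hip.exists_section hr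
  exact ⟨s, hs⟩

/-- If `Ext¹(S, T) = 0`, inflations with cokernel `S` have the left lifting property with
respect to deflations with kernel `T`. -/
lemma Ext1Vanishes.hasLiftingProperty {A B S T Y X : C} (hST : E.Ext1Vanishes S T) {i : A ⟶ B}
    {c : B ⟶ S} (hi : E.IsConflation i c) {k : T ⟶ Y} {p : Y ⟶ X} (hp : E.IsConflation k p) :
    HasLiftingProperty i p := by
  refine ⟨fun {a b} sq => ?_⟩
  obtain ⟨Q, q, b', sq', hq⟩ := E.pullback_deflation p b hp.deflation
  obtain ⟨k', hk', hkq⟩ := hp.exists_of_isPullback sq'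
  let a' : A ⟶ Q := sq'.lift a i sq.w
  have ha₁ : a' ≫ b' = a := by simp [a']
  have ha₂ : a' ≫ q = i := by simp [a']
  have hw := hkq.w
  have hiw := hi.w
  have := hi.mono
  have := hkq.mono
  have := hkq.epi
  -- A lift amounts to a section `s` of `q` with `i ≫ s = a'`, or to a retraction `r` of `k'` that
  -- kills `a'`. The latter is an extension of `biprod.fst` along `m`. Since `m` is the kernel of
  -- the deflation `q ≫ c` onto `S`, the vanishing of `Ext¹(S, T)` provides it.
  let m : T ⊞ A ⟶ Q := biprod.desc k' a'
  have hm : Mono m := by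
    refine Preadditive.mono_of_cancel_zero _ (fun g hg => ?_)
    have hg₂ : g ≫ biprod.snd = 0 := by
      rw [← cancel_mono i]
      have := congr($hg ≫ q)
      simpa [m, biprod.desc_eq, hw, ha₂] using this
    have hg₁ : g ≫ biprod.fst = 0 := by
      rw [← cancel_mono k']
      simpa [m, biprod.desc_eq, reassoc_of% hg₂] using hg
    ext <;> simp [hg₁, hg₂]
  have hconf : E.IsConflation m (q ≫ c) := by
    refine isConflation_of_deflation (E.comp_deflation _ _ hkq.deflation hi.deflation) ?_ ?_
    · ext
      · simp [m, reassoc_of% hw]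
      · simp [m, reassoc_of% ha₂, hiw]
    · intro Z x hx
      obtain ⟨y, hy⟩ := hi.exists_lift (x ≫ q) (by simpa using hx)
      obtain ⟨z, hz⟩ := hkq.exists_lift (x - y ≫ a') (by simp [ha₂, hy])
      exact ⟨biprod.lift z y, by simp [m, hz]⟩
  obtain ⟨r, hr⟩ := hST.exists_extension hconf biprod.fst
  have hr₁ : k' ≫ r = 𝟙 T := by simpa [m] using congr(biprod.inl ≫ $hr)
  have hr₂ : a' ≫ r = 0 := by simpa [m] using congr(biprod.inr ≫ $hr)
  obtain ⟨s, hs, hs'⟩ := hkq.exists_section hr₁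
  refine ⟨⟨⟨s ≫ b', ?_, ?_⟩⟩⟩
  · rw [← ha₂, Category.assoc, reassoc_of% hs']
    simp [ha₁, reassoc_of% hr₂]
  · rw [Category.assoc, sq'.w, reassoc_of% hs]

variable (E) in
/-- The deflations whose kernel is (isomorphic to an object) in `T`. -/
def deflationsWithKernelIn (T : ObjectProperty C) : MorphismProperty C :=
  fun Y _ p => ∃ (X : C) (i : X ⟶ Y), T X ∧ E.IsConflation i p

/-- A lift of `𝟙 M` against a deflation onto `M` is a splitting; the other direction uses the
conflation `0 ⟶ M ⟶ M`. Closure of `^{⊥₁}T` under extensions, summands and filtrations then follows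
from closure properties of left lifting. -/
lemma leftOrth_iff_llp (T : ObjectProperty C) (M : C) :
    E.leftOrth T M ↔ (E.deflationsWithKernelIn T).llp (0 : (0 : C) ⟶ M) := by
  constructor
  · rintro h Y Z p ⟨X, i, hX, hip⟩
    exact (h _ hX).hasLiftingProperty (isConflation_zero_id M) hip
  · intro h Y hY
    rw [ext1Vanishes_iff]
    intro Z i p hip
    have := h p ⟨Y, i, hY, hip⟩
    have sq : CommSq (0 : (0 : C) ⟶ Z) (0 : (0 : C) ⟶ M) p (𝟙 M) := ⟨by simp⟩
    obtain ⟨r, hr, -⟩ := hip.exists_retraction sq.fac_right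
    exact ⟨r, hr⟩

lemma inflationsWithCokernelIn_le_llp {S T : ObjectProperty C} (h : S ≤ E.leftOrth T) :
    E.inflationsWithCokernelIn S ≤ (E.deflationsWithKernelIn T).llp := by
  rintro A B i ⟨X, c, hX, hi⟩ Y Z p ⟨K, k, hK, hp⟩
  exact (h _ hX K hK).hasLiftingProperty hi hp

lemma le_leftOrth_rightOrth (S : ObjectProperty C) : S ≤ E.leftOrth (E.rightOrth S) :=
  fun _ hX _ hY => hY _ hX

lemma isCotorsionPair_leftOrth_rightOrth (S : ObjectProperty C) :
    E.IsCotorsionPair (E.leftOrth (E.rightOrth S)) (E.rightOrth S) :=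
  ⟨le_antisymm (fun _ hY _ hX => hY _ (le_leftOrth_rightOrth S _ hX))
    (fun _ hY _ hX => hX _ hY), rfl⟩

/-- Transfinite compositions of inflations with cokernel in `S` have the left lifting property
with respect to deflations with kernel in `S^{⊥₁}`. -/
lemma transfiniteCompositions_le_llp (S : ObjectProperty C) :
    (E.inflationsWithCokernelIn S).transfiniteCompositions.{v} ≤
      (E.deflationsWithKernelIn (E.rightOrth S)).llp := by
  rw [MorphismProperty.transfiniteCompositions_le_iff]
  exact inflationsWithCokernelIn_le_llp (le_leftOrth_rightOrth S)

/-- Eklof's lemma. -/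
lemma filt_le_leftOrth (S : ObjectProperty C) : E.filt S ≤ E.leftOrth (E.rightOrth S) :=
  fun _ hX => (leftOrth_iff_llp _ _).2 (transfiniteCompositions_le_llp S _ hX)

lemma leftOrth_of_isConflation {T : ObjectProperty C} {X Y Z : C} {i : X ⟶ Y} {p : Y ⟶ Z}
    (h : E.IsConflation i p) (hX : E.leftOrth T X) (hZ : E.leftOrth T Z) : E.leftOrth T Y := by
  rw [leftOrth_iff_llp] at hX ⊢
  have := MorphismProperty.comp_mem _ _ _ hX
    (inflationsWithCokernelIn_le_llp le_rfl _ ⟨Z, p, hZ, h⟩)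
  simpa using this

lemma leftOrth_of_isSummand {T : ObjectProperty C} {M X : C} (h : IsSummand M X)
    (hX : E.leftOrth T X) : E.leftOrth T M := by
  obtain ⟨N, ⟨e⟩⟩ := h
  rw [leftOrth_iff_llp] at hX ⊢
  intro Y Z p hp
  have := hX p hp
  refine ⟨fun {a b} sq => ?_⟩
  have sq' : CommSq (0 : (0 : C) ⟶ Y) (0 : (0 : C) ⟶ X) p (e.inv ≫ biprod.fst ≫ b) := ⟨by simp⟩
  exact ⟨⟨⟨biprod.inl ≫ e.hom ≫ sq'.lift, (isZero_zero C).eq_of_src _ _, by simp⟩⟩⟩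

lemma leftOrth_of_isProjective {T : ObjectProperty C} {P : C} (hP : E.IsProjective P) :
    E.leftOrth T P := by
  intro Y _
  rw [ext1Vanishes_iff]
  intro Z i p hip
  obtain ⟨s, hs⟩ := hP p hip.deflation
  obtain ⟨r, hr, -⟩ := hip.exists_retraction hs
  exact ⟨r, hr⟩

instance (S : ObjectProperty C) : (E.inflationsWithCokernelIn S).IsStableUnderCobaseChange where
  of_isPushout sq := by
    rintro ⟨X, p, hX, h⟩
    obtain ⟨p', -, h'⟩ := h.exists_of_isPushout sq
    exact ⟨X, p', hX, h'⟩

lemma inflationsWithCokernelIn_le (S : ObjectProperty C) :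
    E.inflationsWithCokernelIn S ≤ E.inflations := by
  rintro A B i ⟨X, p, hX, h⟩
  exact h.inflation

end ExactCat.ExactStructure

/-! ### Chains of monomorphisms with repetitions -/

namespace ExactCat

section Transfinite

universe w

variable {C : Type u} [Category.{v} C]

/-- Colimits of functors from linear orders can be computed on cofinal subsets. -/
lemma nonempty_isColimit_of_cofinal {K L : Type*} [LinearOrder K] [LinearOrder L] {s : K → L}
    (hs : Monotone s) (hcof : ∀ l, ∃ k, l ≤ s k) {Φ : L ⥤ C} {Ψ : K ⥤ C}
    (e : ∀ k, Ψ.obj k ≅ Φ.obj (s k))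
    (he : ∀ k k' (h : k ≤ k'), Ψ.map (homOfLE h) ≫ (e k').hom =
      (e k).hom ≫ Φ.map (homOfLE (hs h)))
    {d : Cocone Ψ} (hd : IsColimit d) (c : Cocone Φ) (t : d.pt ≅ c.pt)
    (ht : ∀ k, d.ι.app k ≫ t.hom = (e k).hom ≫ c.ι.app (s k)) : Nonempty (IsColimit c) := by
  have : hs.functor.Final := hs.final_functor_iff.2 hcof
  let α : Ψ ≅ hs.functor ⋙ Φ := NatIso.ofComponents e (fun f => he _ _ (leOfHom f))
  refine ⟨(Functor.Final.isColimitWhiskerEquiv hs.functor c).1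
    ((IsColimit.precomposeHomEquiv α (c.whisker hs.functor)).1 (hd.ofIsoColimit (Cocone.ext t ?_)))⟩
  exact ht

/-- A diagram of subobjects indexed by a well-ordered type, in which some of the steps may be
isomorphisms, gives rise to a transfinite composition, obtained by removing repetitions. -/
theorem transfiniteCompositions_of_mono {L : Type w} [LinearOrder L] [OrderBot L]
    [WellFoundedLT L] (W : MorphismProperty C) [W.RespectsIso] {Φ : L ⥤ C}
    [hΦ : ∀ ⦃l l'⦄ (f : l ⟶ l'), Mono (Φ.map f)]
    (H : ∀ l : L, l ≠ ⊥ → (∃ (m : L) (h : m < l), (∀ x < l, x ≤ m) ∧ W (Φ.map (homOfLE h.le))) ∨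
      Nonempty (IsColimit ((Set.principalSegIio l).cocone Φ)))
    {c : Cocone Φ} (hc : IsColimit c) :
    W.transfiniteCompositions.{w} (c.ι.app ⊥) := by
  classical
  -- `r l` is the first index whose object already maps isomorphically onto `Φ.obj l`. The fixed
  -- points of `r` form the reindexed chain `L'`, on which no transition map between distinct
  -- indices is an isomorphism.
  let A (l : L) : Set L := {m | ∃ h : m ≤ l, IsIso (Φ.map (homOfLE h))}
  have hA (l : L) : l ∈ A l := ⟨le_rfl, by
    have : homOfLE (le_refl l) = 𝟙 l := rfl
    rw [this]; infer_instance⟩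
  let r (l : L) : L := WellFounded.min (wellFounded_lt (α := L)) (A l) ⟨l, hA l⟩
  have hr (l : L) : r l ∈ A l := WellFounded.min_mem _ _ _
  have r_le (l : L) : r l ≤ l := (hr l).1
  have r_iso (l : L) : IsIso (Φ.map (homOfLE (r_le l))) := (hr l).2
  have r_min {m l : L} (h : m ≤ l) (hi : IsIso (Φ.map (homOfLE h))) : r l ≤ m :=
    le_of_not_gt (WellFounded.not_lt_min _ _ (show m ∈ A l from ⟨h, hi⟩))
  have iso_trans {x y z : L} (h₁ : x ≤ y) (h₂ : y ≤ z) (_ : IsIso (Φ.map (homOfLE h₁)))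
      (_ : IsIso (Φ.map (homOfLE h₂))) : IsIso (Φ.map (homOfLE (h₁.trans h₂))) := by
    rw [← homOfLE_comp h₁ h₂, Φ.map_comp]; infer_instance
  have r_r (l : L) : r (r l) = r l := le_antisymm (r_le _)
    (r_min ((r_le _).trans (r_le l)) (iso_trans _ _ (r_iso _) (r_iso l)))
  have r_mono : Monotone r := by
    intro l l' h
    rcases le_total l (r l') with h' | h'
    · exact (r_le l).trans h'
    · refine r_min h' ?_
      -- Here `r l' ≤ l ≤ l'`, and the isomorphism from `r l'` to `l'` factors through the
      -- monomorphism from `l` to `l'`. That monomorphism is therefore a split epimorphism, so both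
      -- factors are isomorphisms.
      have h₁ := r_iso l'
      have : Φ.map (homOfLE (r_le l')) = Φ.map (homOfLE h') ≫ Φ.map (homOfLE h) := by
        rw [← Φ.map_comp]; rfl
      rw [this] at h₁
      have : IsSplitEpi (Φ.map (homOfLE h)) :=
        ⟨⟨⟨inv (Φ.map (homOfLE h') ≫ Φ.map (homOfLE h)) ≫ Φ.map (homOfLE h'), by simp⟩⟩⟩
      have : IsIso (Φ.map (homOfLE h)) := isIso_of_mono_of_isSplitEpi _
      exact IsIso.of_isIso_comp_right (Φ.map (homOfLE h')) (Φ.map (homOfLE h))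
  let σ (l : L) : Φ.obj (r l) ≅ Φ.obj l := @asIso _ _ _ _ _ (r_iso l)
  have σ_hom (l : L) : (σ l).hom = Φ.map (homOfLE (r_le l)) := rfl
  have σ_nat {x x' : L} (h : x ≤ x') :
      Φ.map (homOfLE h) ≫ (σ x').inv = (σ x).inv ≫ Φ.map (homOfLE (r_mono h)) := by
    rw [Iso.comp_inv_eq, Category.assoc, Iso.eq_inv_comp, σ_hom, σ_hom, ← Φ.map_comp,
      ← Φ.map_comp]
    rfl
  let L' : Type w := {l : L // r l = l}
  let _ : OrderBot L' :=
    { bot := ⟨⊥, le_bot_iff.1 (r_le ⊥)⟩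
      bot_le := fun x => (bot_le : ⊥ ≤ x.1) }
  let _ : SuccOrder L' := SuccOrder.ofLinearWellFoundedLT L'
  let ρ (l : L) : L' := ⟨r l, r_r l⟩
  have ρ_mono : Monotone ρ := fun _ _ h => r_mono h
  let ι : L' → L := Subtype.val
  have ι_mono : Monotone ι := Subtype.mono_coe _
  let G : L' ⥤ C := ι_mono.functor ⋙ Φ
  have hcol {y : L'} (hy : Nonempty (IsColimit ((Set.principalSegIio y.1).cocone Φ))) :
      Nonempty (IsColimit ((Set.principalSegIio y).cocone G)) := by
    let s : Set.Iio y.1 → Set.Iio y := fun x => ⟨ρ x.1, (r_le x.1).trans_lt x.2⟩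
    have hs : Monotone s := fun _ _ h => ρ_mono h
    refine nonempty_isColimit_of_cofinal (s := s) hs ?_
      (fun x => (σ x.1).symm) ?_ hy.some _ (Iso.refl _) ?_
    · exact fun x => ⟨⟨x.1.1, x.2⟩, x.1.2.ge⟩
    · intro x x' h
      exact σ_nat _
    · intro x
      refine (Category.comp_id _).trans ((Iso.eq_inv_comp _).2 ?_)
      exact (Φ.map_comp (homOfLE (r_le x.1)) (homOfLE (le_of_lt x.2))).symm
  have hsucc {x y : L'} (hxy : x < y) (hy : ∀ z < y, z ≤ x) :
      W (Φ.map (homOfLE (show x.1 ≤ y.1 from hxy.le))) := by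
    rcases H y.1 (ne_bot_of_gt (show x.1 < y.1 from hxy)) with ⟨m, hm, hm', hW⟩ | hcy
    · have hρ : ρ m = x := le_antisymm (hy _ ((r_le m).trans_lt hm))
        (by rw [← show ρ x.1 = x from Subtype.ext x.2]; exact ρ_mono (hm' _ hxy))
      subst hρ
      have := r_iso m
      rw [show Φ.map (homOfLE (show (ρ m).1 ≤ y.1 from hxy.le)) = Φ.map (homOfLE (r_le m)) ≫
        Φ.map (homOfLE hm.le) by rw [← Φ.map_comp]; rfl]
      exact MorphismProperty.RespectsIso.precomp _ _ _ hW
    -- If `y` were a colimit stage of `Φ` with immediate predecessor `x` in `L'`, then `x` would be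
    -- terminal below `y`, so `x ⟶ y` would be an isomorphism, contradicting `r y = y`.
    · exfalso
      let x' : Set.Iio y := ⟨x, hxy⟩
      have hx' : IsTerminal x' := IsTerminal.ofUniqueHom
        (fun z => homOfLE (hy _ z.2)) (fun _ _ => rfl)
      have := (hcol hcy).some.isIso_ι_app_of_isTerminal x' hx'
      exact (y.2 ▸ r_min (show x.1 ≤ y.1 from hxy.le) this).not_gt hxy
  have hG : G.IsWellOrderContinuous := ⟨fun y hy => by
    rcases H y.1 (fun h => hy.1 (by
      intro z _; exact (show y.1 ≤ z.1 from h ▸ bot_le))) with ⟨m, hm, hm', hW⟩ | hcy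
    · exfalso
      refine hy.2 (ρ m) ⟨(r_le m).trans_lt hm, fun z hz hz' => ?_⟩
      have : z ≤ ρ m := by
        rw [← show ρ z.1 = z from Subtype.ext z.2]; exact ρ_mono (hm' _ hz')
      exact this.not_gt hz
    · exact hcol hcy⟩
  have hc' : Nonempty (IsColimit (c.whisker ι_mono.functor)) := by
    refine nonempty_isColimit_of_cofinal ρ_mono ?_
      (fun x => (σ x).symm) ?_ hc _ (Iso.refl _) ?_
    · exact fun x => ⟨x.1, x.2.ge⟩
    · intro x x' h
      exact σ_nat h
    · intro x
      refine (Category.comp_id _).trans ((Iso.eq_inv_comp _).2 ?_)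
      exact c.w _
  rw [MorphismProperty.transfiniteCompositions_iff]
  exact ⟨L', inferInstance, inferInstance, inferInstance, inferInstance,
    ⟨{F := G
      isoBot := Iso.refl _
      incl := (c.whisker ι_mono.functor).ι
      isColimit := hc'.some
      fac := Category.id_comp _
      map_mem := fun x hx => hsucc (Order.lt_succ_of_not_isMax hx)
        (fun z hz => Order.le_of_lt_succ hz) }⟩⟩

end Transfinite

end ExactCat

/-! ### Transfinite compositions of transfinite compositions -/

namespace ExactCat

section Transfinite

universe w

variable {C : Type u} [Category.{v} C]

/-- The diagram given by a monotone family of subobjects of `Y`. -/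
noncomputable def functorOfMono {L : Type*} [Preorder L] {Y : C} (X : L → C) (q : ∀ l, X l ⟶ Y)
    [∀ l, Mono (q l)] (hq : ∀ l l', l ≤ l' → ∃ u : X l ⟶ X l', u ≫ q l' = q l) : L ⥤ C where
  obj := X
  map f := (hq _ _ (leOfHom f)).choose
  map_id l := by rw [← cancel_mono (q l), (hq _ _ le_rfl).choose_spec, Category.id_comp]
  map_comp f g := by
    rw [← cancel_mono (q _), Category.assoc, (hq _ _ (leOfHom g)).choose_spec,
      (hq _ _ (leOfHom f)).choose_spec, (hq _ _ (leOfHom (f ≫ g))).choose_spec]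

lemma functorOfMono_map_comp {L : Type*} [Preorder L] {Y : C} (X : L → C) (q : ∀ l, X l ⟶ Y)
    [∀ l, Mono (q l)] (hq : ∀ l l', l ≤ l' → ∃ u : X l ⟶ X l', u ≫ q l' = q l) {l l' : L}
    (f : l ⟶ l') : (functorOfMono X q hq).map f ≫ q l' = q l :=
  (hq _ _ (leOfHom f)).choose_spec

instance wellFoundedLT_sigmaLex {J : Type*} [LinearOrder J] [WellFoundedLT J] (K : J → Type*)
    [∀ j, LinearOrder (K j)] [∀ j, WellFoundedLT (K j)] : WellFoundedLT (Σₗ j, K j) := by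
  refine ⟨⟨fun ⟨j, a⟩ => ?_⟩⟩
  induction j using WellFoundedLT.induction with | _ j hj
  induction a using WellFoundedLT.induction with | _ a ha
  refine ⟨_, fun y hy => ?_⟩
  rcases hy with ⟨_, _, h⟩ | ⟨_, _, h⟩
  · exact hj _ h _
  · exact ha _ h

/-- Transfinite compositions of transfinite compositions of monomorphisms are
transfinite compositions. -/
theorem transfiniteCompositions_of_transfiniteCompositions (W M : MorphismProperty C)
    [W.RespectsIso] (hWM : W ≤ M) (hM : M ≤ MorphismProperty.monomorphisms C)
    [MorphismProperty.IsStableUnderTransfiniteComposition.{w} M]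
    {J : Type w} [LinearOrder J] [SuccOrder J] [OrderBot J] [WellFoundedLT J]
    (K : J → Type w) [∀ j, LinearOrder (K j)] [∀ j, SuccOrder (K j)] [∀ j, OrderBot (K j)]
    [∀ j, WellFoundedLT (K j)] {X Y : C} {f : X ⟶ Y}
    (h : M.TransfiniteCompositionOfShape J f)
    (h' : ∀ j, W.TransfiniteCompositionOfShape (K j) (h.F.map (homOfLE (Order.le_succ j)))) :
    W.transfiniteCompositions.{w} f := by
  -- The chains refining the individual steps are concatenated lexicographically. Every object
  -- involved is a subobject of `Y` through `q`, so commutativity is always checked after composing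
  -- into `Y`.
  let L := Σₗ j, K j
  let k (j : J) (a : K j) : L := toLex ⟨j, a⟩
  have hk {l : L} {j : J} {a : K j} (hl : l < k j a) :
      (∃ j' b, j' < j ∧ l = k j' b) ∨ ∃ b < a, l = k j b := by
    rcases hl with ⟨b, _, h⟩ | ⟨b, _, h⟩
    · exact Or.inl ⟨_, _, h, rfl⟩
    · exact Or.inr ⟨_, h, rfl⟩
  have lt_left {j j' : J} (h : j < j') (a : K j) (b : K j') : k j a < k j' b :=
    Sigma.Lex.left _ _ h
  have lt_right {j : J} {a b : K j} (h : a < b) : k j a < k j b := Sigma.Lex.right _ _ h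
  have le_right {j : J} {a b : K j} (h : a ≤ b) : k j a ≤ k j b := Sigma.Lex.right _ _ h
  let Q (j : J) (a : K j) : (h' j).F.obj a ⟶ Y :=
    (h' j).incl.app a ≫ h.incl.app (Order.succ j)
  have hQM (j : J) (a : K j) : M (Q j a) :=
    M.comp_mem _ _ (((h' j).ofLE hWM).mem_incl_app a) (h.mem_incl_app _)
  have hQmap {j : J} {a b : K j} (g : a ⟶ b) : (h' j).F.map g ≫ Q j b = Q j a := by
    dsimp [Q]
    rw [← Category.assoc, (h' j).incl.naturality]
    simp
  have hQbot (j : J) : (h' j).isoBot.inv ≫ Q j ⊥ = h.incl.app j := by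
    dsimp [Q]
    rw [← Category.assoc, (h' j).fac, h.incl.naturality]
    simp
  have hinc {i i' : J} (g : i ⟶ i') : h.F.map g ≫ h.incl.app i' = h.incl.app i := by simp
  let O (l : L) : C := (h' (ofLex l).1).F.obj (ofLex l).2
  let q (l : L) : O l ⟶ Y := Q (ofLex l).1 (ofLex l).2
  have hqm (l : L) : Mono (q l) := hM _ (hQM _ _)
  have hbot (j : J) : (h' j).isoBot.inv ≫ q (k j ⊥) = h.incl.app j := hQbot j
  have hq (l l' : L) (hl : l ≤ l') : ∃ u : O l ⟶ O l', u ≫ q l' = q l := by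
    rcases hl with @⟨j, j', b, c, hl⟩ | @⟨j, b, c, hl⟩
    · have : ((h' j).incl.app b ≫ h.F.map (homOfLE (Order.succ_le_of_lt hl)) ≫
          (h' j').isoBot.inv ≫ (h' j').F.map (homOfLE bot_le)) ≫ Q j' c = Q j b := by
        rw [Category.assoc, Category.assoc, Category.assoc, hQmap, hQbot, hinc]
      exact ⟨_, this⟩
    · exact ⟨(h' j).F.map (homOfLE hl), hQmap _⟩
  let Φ : L ⥤ C := functorOfMono O q hq
  have hΦ {l l' : L} (g : l ⟶ l') : Φ.map g ≫ q l' = q l := functorOfMono_map_comp _ _ _ g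
  have : ∀ ⦃l l' : L⦄ (f : l ⟶ l'), Mono (Φ.map f) := fun l l' g =>
    @mono_of_mono_fac _ _ _ _ _ _ _ _ (hqm l) (hΦ g)
  let c : Cocone Φ :=
    { pt := Y
      ι := { app := q, naturality := fun _ _ g => (hΦ g).trans (Category.comp_id _).symm } }
  have hmap {j : J} {a b : K j} (hab : a ≤ b) :
      Φ.map (homOfLE (le_right hab)) = (h' j).F.map (homOfLE hab) := by
    exact (cancel_mono (q (k j b))).1 ((hΦ _).trans (hQmap (homOfLE hab)).symm)
  have kbot_mono : Monotone (fun j => k j ⊥) := fun i i' h => by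
    rcases h.lt_or_eq with h | rfl
    · exact (lt_left h _ _).le
    · exact le_rfl
  have hnat {i i' : J} (hi : i ≤ i') : h.F.map (homOfLE hi) ≫ (h' i').isoBot.inv =
      (h' i).isoBot.inv ≫ Φ.map (homOfLE (kbot_mono hi)) := by
    refine (cancel_mono (q (k i' ⊥))).1 (((Category.assoc _ _ _).trans ?_).trans
      (Category.assoc _ _ _).symm)
    exact (congr(_ ≫ $(hbot i')).trans (hinc _)).trans
      ((hbot i).symm.trans congr(_ ≫ $((hΦ (homOfLE (kbot_mono hi))).symm)))
  have hlast {j : J} (hj : j < Order.succ j) (a : K j) :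
      (h' j).incl.app a ≫ (h' (Order.succ j)).isoBot.inv =
        Φ.map (homOfLE (lt_left hj a ⊥).le) := by
    refine (cancel_mono (q (k _ ⊥))).1 (((Category.assoc _ _ _).trans ?_).trans
      (hΦ (homOfLE (lt_left hj a ⊥).le)).symm)
    exact congr(_ ≫ $(hbot _))
  -- The bottom of the block of `succ j` is the colimit of the block of `j`. If `K j` has a greatest
  -- element, the object is merely repeated; this is why `transfiniteCompositions_of_mono` must
  -- tolerate colimit stages at successor indices.
  have hsucc (j j' : J) (hjj : Order.succ j = j') (x : K j') (hx : IsBot x) (hj : ¬ IsMax j) :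
      Nonempty (IsColimit ((Set.principalSegIio (k j' x)).cocone Φ)) := by
    subst hjj
    obtain rfl : x = ⊥ := le_bot_iff.1 (hx _)
    have hlt : j < Order.succ j := Order.lt_succ_of_not_isMax hj
    let s : K j → Set.Iio (k (Order.succ j) ⊥) := fun a => ⟨k j a, lt_left hlt _ _⟩
    have hs : Monotone s := fun _ _ h => le_right h
    refine nonempty_isColimit_of_cofinal hs ?_ (fun a => Iso.refl _) ?_ (h' j).isColimit _
      (h' (Order.succ j)).isoBot.symm ?_
    · rintro ⟨l, hl⟩
      rcases hk hl with ⟨j', b, hj', rfl⟩ | ⟨b, hb, rfl⟩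
      · rcases (Order.le_of_lt_succ hj').lt_or_eq with h | rfl
        · exact ⟨⊥, (lt_left h _ _).le⟩
        · exact ⟨b, le_rfl⟩
      · exact (not_lt_bot hb).elim
    · intro a a' ha
      exact (Category.comp_id _).trans ((hmap ha).symm.trans (Category.id_comp _).symm)
    · intro a
      exact (hlast hlt a).trans (Category.id_comp _).symm
  have hlim (j : J) (hj : Order.IsSuccLimit j) (x : K j) (hx : IsBot x) :
      Nonempty (IsColimit ((Set.principalSegIio (k j x)).cocone Φ)) := by
    obtain rfl : x = ⊥ := le_bot_iff.1 (hx _)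
    let s : Set.Iio j → Set.Iio (k j ⊥) := fun i => ⟨k i.1 ⊥, lt_left i.2 _ _⟩
    have hs : Monotone s := fun _ _ h => kbot_mono h
    refine nonempty_isColimit_of_cofinal hs ?_ (fun i => (h' i.1).isoBot.symm) ?_
      (h.F.isColimitOfIsWellOrderContinuous j hj) _ (h' j).isoBot.symm ?_
    · rintro ⟨l, hl⟩
      rcases hk hl with ⟨j', b, hj', rfl⟩ | ⟨b, hb, rfl⟩
      · exact ⟨⟨Order.succ j', hj.succ_lt hj'⟩,
          (lt_left (Order.lt_succ_of_not_isMax hj'.not_isMax) _ _).le⟩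
      · exact (not_lt_bot hb).elim
    · intro i i' hi
      exact hnat hi
    · intro i
      exact hnat (le_of_lt i.2)
  have hright (j : J) (x : K j) (hx : Order.IsSuccLimit x) :
      Nonempty (IsColimit ((Set.principalSegIio (k j x)).cocone Φ)) := by
    let s : Set.Iio x → Set.Iio (k j x) := fun i => ⟨k j i.1, lt_right i.2⟩
    have hs : Monotone s := fun i i' h => le_right h
    refine nonempty_isColimit_of_cofinal hs ?_ (fun i => Iso.refl _) ?_
      ((h' j).F.isColimitOfIsWellOrderContinuous x hx) _ (Iso.refl _) ?_
    · rintro ⟨l, hl⟩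
      rcases hk hl with ⟨j', b, hj', rfl⟩ | ⟨b, hb, rfl⟩
      · exact ⟨⟨⊥, hx.bot_lt⟩, (lt_left hj' _ _).le⟩
      · exact ⟨⟨b, hb⟩, le_rfl⟩
    · intro a a' ha
      exact (Category.comp_id _).trans ((hmap ha).symm.trans (Category.id_comp _).symm)
    · intro a
      exact (Category.comp_id _).trans ((hmap (le_of_lt a.2)).symm.trans (Category.id_comp _).symm)
  have hc : Nonempty (IsColimit c) := by
    -- At a maximal `m` one has `succ m = m`, yet `h' m` still decomposes that trivial step and
    -- contributes a last block to `L`. The colimit is then computed on this block; without a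
    -- maximum it is computed on the bottoms of the blocks.
    by_cases hJ : ∃ m : J, IsMax m
    · obtain ⟨m, hm⟩ := hJ
      have hm' : Order.succ m = m := Order.succ_eq_iff_isMax.2 hm
      have hterm : IsTerminal m := IsTerminal.ofUniqueHom
        (fun z => homOfLE (hm.isTop z)) (fun _ _ => rfl)
      have : IsIso (h.incl.app (Order.succ m)) :=
        h.isColimit.isIso_ι_app_of_isTerminal (Order.succ m) (hm'.symm ▸ hterm)
      have hs : Monotone (k m) := fun _ _ h => le_right h
      refine nonempty_isColimit_of_cofinal hs ?_ (fun a => Iso.refl _) ?_ (h' m).isColimit c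
        (asIso (h.incl.app (Order.succ m))) ?_
      · rintro ⟨j, b⟩
        rcases (hm.isTop j).lt_or_eq with h | rfl
        · exact ⟨⊥, (lt_left h _ _).le⟩
        · exact ⟨b, le_rfl⟩
      · intro a a' ha
        exact (Category.comp_id _).trans ((hmap ha).symm.trans (Category.id_comp _).symm)
      · intro a
        exact (Category.id_comp _).symm
    · refine nonempty_isColimit_of_cofinal kbot_mono ?_ (fun i => (h' i).isoBot.symm) ?_ h.isColimit c
        (Iso.refl _) ?_
      · rintro ⟨j, b⟩
        exact ⟨Order.succ j, (lt_left (Order.lt_succ_of_not_isMax fun h => hJ ⟨_, h⟩) _ _).le⟩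
      · intro i i' hi
        exact hnat hi
      · intro i
        exact (Category.comp_id _).trans (hbot i).symm
  have key : W.transfiniteCompositions.{w} (c.ι.app ⊥) := by
    refine transfiniteCompositions_of_mono W ?_ hc.some
    rintro ⟨j, x⟩ hl
    induction x using SuccOrder.limitRecOn with
    | isMin x hx =>
      right
      have hx' : IsBot x := hx.isBot
      clear hx
      induction j using SuccOrder.limitRecOn with
      | isMin j hj =>
        obtain rfl := hj.eq_bot
        obtain rfl : x = ⊥ := le_bot_iff.1 (hx' _)
        exact (hl rfl).elim
      | succ j hj _ => exact hsucc j _ rfl x hx' hj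
      | isSuccLimit j hj _ => exact hlim j hj x hx'
    | succ x hx _ =>
      left
      refine ⟨k j x, lt_right (Order.lt_succ_of_not_isMax hx), ?_, ?_⟩
      · intro y hy
        rcases hk hy with ⟨j', b, hj', rfl⟩ | ⟨b, hb, rfl⟩
        · exact (lt_left hj' _ _).le
        · exact le_right (Order.le_of_lt_succ hb)
      · have := (h' j).map_mem x hx
        rw [← hmap] at this
        exact this
    | isSuccLimit x hx _ => exact Or.inr (hright j x hx)
  have hWr : (W.transfiniteCompositions.{w}).RespectsIso :=
    MorphismProperty.RespectsIso.of_respects_arrow_iso _ (fun f g e hf => by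
      rw [MorphismProperty.transfiniteCompositions_iff] at hf ⊢
      obtain ⟨J, _, _, _, _, hf⟩ := hf
      exact ⟨J, _, _, _, _, (MorphismProperty.arrow_mk_iso_iff _ e).1 hf⟩)
  have e : Arrow.mk (c.ι.app ⊥) ≅ Arrow.mk f :=
    Arrow.isoMk ((h' ⊥).isoBot ≪≫ h.isoBot) (Iso.refl _) (by
      refine ((Category.assoc _ _ _).trans ?_).trans (Category.comp_id _).symm
      refine (congr(_ ≫ _ ≫ $(h.fac.symm))).trans ?_
      refine (congr(_ ≫ $(h.isoBot.hom_inv_id_assoc _))).trans ?_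
      rw [← hbot]
      exact (h' ⊥).isoBot.hom_inv_id_assoc _)
  exact (MorphismProperty.arrow_mk_iso_iff _ e).1 key

end Transfinite

end ExactCat

/-! ### Stability of transfinite compositions under composition and pushout -/

namespace ExactCat

section Transfinite

universe w

variable {C : Type u} [Category.{v} C]

instance respectsIso_transfiniteCompositions (W : MorphismProperty C) :
    (MorphismProperty.transfiniteCompositions.{w} W).RespectsIso :=
  MorphismProperty.RespectsIso.of_respects_arrow_iso _ (fun f g e hf => by
    rw [MorphismProperty.transfiniteCompositions_iff] at hf ⊢
    obtain ⟨J, _, _, _, _, hf⟩ := hf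
    exact ⟨J, _, _, _, _, (MorphismProperty.arrow_mk_iso_iff _ e).1 hf⟩)

lemma transfiniteCompositions_of_isIso (W : MorphismProperty C) {X Y : C} (f : X ⟶ Y)
    [IsIso f] : MorphismProperty.transfiniteCompositions.{w} W f := by
  have h : MorphismProperty.transfiniteCompositions.{w} W (𝟙 X) :=
    MorphismProperty.transfiniteCompositionsOfShape_le_transfiniteCompositions _ _ _
      ((MorphismProperty.TransfiniteCompositionOfShape.id W X).ofOrderIso
        (orderIsoShrink.{w} (Fin 1)).symm).mem
  simpa using MorphismProperty.RespectsIso.postcomp _ f _ h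

lemma isStableUnderTransfiniteComposition_transfiniteCompositions (W M : MorphismProperty C)
    [W.RespectsIso] (hWM : W ≤ M) (hM : M ≤ MorphismProperty.monomorphisms C)
    [MorphismProperty.IsStableUnderTransfiniteComposition.{w} M] :
    MorphismProperty.IsStableUnderTransfiniteComposition.{w}
      (MorphismProperty.transfiniteCompositions.{w} W) where
  isStableUnderTransfiniteCompositionOfShape J _ _ _ _ := ⟨by
    rintro X Y f ⟨h⟩
    have h₁ (j : J) : MorphismProperty.transfiniteCompositions.{w} W
        (h.F.map (homOfLE (Order.le_succ j))) := by
      -- `map_mem` says nothing at a maximal `j`, where the step is an isomorphism.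
      by_cases hj : IsMax j
      · have : IsIso (homOfLE (Order.le_succ j)) :=
          ⟨homOfLE (Order.succ_eq_iff_isMax.2 hj).le, rfl, rfl⟩
        exact transfiniteCompositions_of_isIso _ _
      · exact h.map_mem j hj
    simp only [MorphismProperty.transfiniteCompositions_iff] at h₁
    choose K _ _ _ _ h' using h₁
    exact transfiniteCompositions_of_transfiniteCompositions W M hWM hM K
      (h.ofLE ((MorphismProperty.transfiniteCompositions_le_iff).2 hWM)) (fun j => (h' j).some)⟩

/-- Pushouts commute with colimits. -/
lemma nonempty_isColimit_of_isPushout {K : Type*} [Preorder K] {k₀ : K} (hk₀ : ∀ k, k₀ ≤ k)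
    {Ψ P : K ⥤ C} {d : Cocone Ψ} (hd : IsColimit d) (p : Cocone P) {X : C}
    (t : Ψ.obj k₀ ⟶ X) (inl : ∀ k, X ⟶ P.obj k) (inr : ∀ k, Ψ.obj k ⟶ P.obj k)
    (jl : X ⟶ p.pt) (jr : d.pt ⟶ p.pt)
    (h : ∀ k, IsPushout t (Ψ.map (homOfLE (hk₀ k))) (inl k) (inr k))
    (hp : IsPushout t (d.ι.app k₀) jl jr)
    (hinl : ∀ k k' (h : k ≤ k'), inl k ≫ P.map (homOfLE h) = inl k')
    (hinr : ∀ k k' (h : k ≤ k'), inr k ≫ P.map (homOfLE h) = Ψ.map (homOfLE h) ≫ inr k')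
    (hjl : ∀ k, inl k ≫ p.ι.app k = jl) (hjr : ∀ k, inr k ≫ p.ι.app k = d.ι.app k ≫ jr) :
    Nonempty (IsColimit p) := by
  let D (s : Cocone P) : Cocone Ψ :=
    { pt := s.pt
      ι :=
        { app := fun k => inr k ≫ s.ι.app k
          naturality := fun k k' f => by
            have := hinr k k' (leOfHom f)
            have h₂ := s.w f
            dsimp
            rw [Category.comp_id, ← h₂]
            exact (Category.assoc _ _ _).symm.trans
              (congr($(this.symm) ≫ _).trans (Category.assoc _ _ _)) } }
  have hD (s : Cocone P) : t ≫ inl k₀ ≫ s.ι.app k₀ = d.ι.app k₀ ≫ hd.desc (D s) := by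
    rw [hd.fac, ← Category.assoc, (h k₀).w, Category.assoc]
    have : Ψ.map (homOfLE (hk₀ k₀)) = 𝟙 _ := Ψ.map_id _
    rw [this, Category.id_comp]
  refine ⟨{
    desc := fun s => hp.desc (inl k₀ ≫ s.ι.app k₀) (hd.desc (D s)) (hD s)
    fac := fun s k => ?_
    uniq := fun s m hm => ?_ }⟩
  · apply (h k).hom_ext
    · rw [reassoc_of% hjl, hp.inl_desc, ← s.w (homOfLE (hk₀ k)), ← Category.assoc, hinl]
    · rw [reassoc_of% hjr, hp.inr_desc, hd.fac]
  · apply hp.hom_ext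
    · rw [hp.inl_desc, ← hm, reassoc_of% hjl]
    · rw [hp.inr_desc]
      refine hd.hom_ext (fun k => ?_)
      rw [hd.fac, ← reassoc_of% hjr, hm]

/-- Each partial composite `F ⊥ ⟶ F j` lies in `M`, so it can be pushed out along `t`. By pasting,
each step of the new chain is a pushout of the corresponding old step, and since pushouts commute
with colimits the new chain is continuous with colimit `Y'`. -/
lemma transfiniteCompositions_of_isPushout (W M : MorphismProperty C)
    [W.IsStableUnderCobaseChange] (hWM : W ≤ M)
    [MorphismProperty.IsStableUnderTransfiniteComposition.{w} M]
    (hpush : ∀ ⦃A B X : C⦄ (i : A ⟶ B) (t : A ⟶ X), M i → HasPushout t i)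
    {X Y X' Y' : C} {f : X ⟶ Y} {t : X ⟶ X'} {f' : X' ⟶ Y'} {b : Y ⟶ Y'}
    (sq : IsPushout t f f' b) (hf : MorphismProperty.transfiniteCompositions.{w} W f) :
    MorphismProperty.transfiniteCompositions.{w} W f' := by
  rw [MorphismProperty.transfiniteCompositions_iff] at hf
  obtain ⟨J, _, _, _, _, ⟨h⟩⟩ := hf
  let F := h.F
  let t₀ : F.obj ⊥ ⟶ X' := h.isoBot.hom ≫ t
  let i (j : J) : F.obj ⊥ ⟶ F.obj j := F.map (homOfLE bot_le)
  have hi {j j' : J} (g : j ⟶ j') : i j ≫ F.map g = i j' := by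
    dsimp [i]; rw [← F.map_comp]; rfl
  have hM (j : J) : M (i j) := (h.ofLE hWM).mem_map _
  have hpo (j : J) : HasPushout t₀ (i j) := hpush _ _ (hM j)
  let Q (j : J) : C := pushout t₀ (i j)
  let inl (j : J) : X' ⟶ Q j := pushout.inl _ _
  let inr (j : J) : F.obj j ⟶ Q j := pushout.inr _ _
  have hP (j : J) : IsPushout t₀ (i j) (inl j) (inr j) := IsPushout.of_hasPushout _ _
  have hQ (j j' : J) (g : j ⟶ j') : ∃ u : Q j ⟶ Q j', inl j ≫ u = inl j' ∧
      inr j ≫ u = F.map g ≫ inr j' :=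
    ⟨(hP j).desc (inl j') (F.map g ≫ inr j') (by rw [reassoc_of% hi g, (hP j').w]), by simp,
      by simp⟩
  choose u hul hur using hQ
  let P : J ⥤ C :=
    { obj := Q
      map := fun g => u _ _ g
      map_id := fun j => by
        apply (hP j).hom_ext
        · rw [hul, Category.comp_id]
        · rw [hur, F.map_id, Category.comp_id, Category.id_comp]
      map_comp := fun g g' => by
        apply (hP _).hom_ext
        · rw [hul, reassoc_of% hul, hul]
        · rw [hur, reassoc_of% hur, hur, F.map_comp, Category.assoc] }
  have hinl {j j' : J} (g : j ⟶ j') : inl j ≫ P.map g = inl j' := hul _ _ g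
  have hinr {j j' : J} (g : j ⟶ j') : inr j ≫ P.map g = F.map g ≫ inr j' := hur _ _ g
  have hP' {j j' : J} (g : j ⟶ j') : IsPushout (F.map g) (inr j) (inr j') (P.map g) := by
    refine IsPushout.of_left ?_ (hinr g).symm (hP j).flip
    rw [hi, hinl]
    exact (hP j').flip
  have hc : P.IsWellOrderContinuous := ⟨fun m hm => by
    refine nonempty_isColimit_of_isPushout (k₀ := (⟨⊥, hm.bot_lt⟩ : Set.Iio m))
      (fun k => (bot_le : ⊥ ≤ k.1)) (F.isColimitOfIsWellOrderContinuous m hm) _ t₀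
      (fun k => inl k.1) (fun k => inr k.1) (inl m) (inr m) (fun k => hP k.1) (hP m)
      (fun _ _ h => hinl _) (fun _ _ h => hinr _) (fun k => hinl _) (fun k => hinr _)⟩
  have hfac : h.incl.app ⊥ = h.isoBot.hom ≫ f := (Iso.inv_comp_eq _).1 h.fac
  let p (j : J) : P.obj j ⟶ Y' := pushout.desc f' (h.incl.app j ≫ b) (by
    simp only [t₀, Category.assoc, sq.w]
    rw [← reassoc_of% hfac]
    simp [i, F])
  have hpl (j : J) : inl j ≫ p j = f' := pushout.inl_desc _ _ _
  have hpr (j : J) : inr j ≫ p j = h.incl.app j ≫ b := pushout.inr_desc _ _ _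
  let c : Cocone P :=
    { pt := Y'
      ι :=
        { app := p
          naturality := fun j j' g => by
            refine Eq.trans ?_ (Category.comp_id _).symm
            apply (hP j).hom_ext
            · rw [reassoc_of% hinl g, hpl, hpl]
            · rw [reassoc_of% hinr g, hpr, hpr]
              simp [F] } }
  have hsq : IsPushout t₀ (h.incl.app ⊥) f' b := by
    refine sq.of_iso h.isoBot.symm (Iso.refl _) (Iso.refl _) (Iso.refl _) ?_ ?_ ?_ ?_
    · simp [t₀]
    · simp
    · simp
    · simp
  obtain ⟨hcc⟩ := nonempty_isColimit_of_isPushout (k₀ := (⊥ : J)) (fun _ => bot_le)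
    h.isColimit c t₀ inl inr f' b hP hsq (fun _ _ _ => hinl _) (fun _ _ _ => hinr _) hpl hpr
  have hbot : IsIso (inl ⊥) := by
    have : i ⊥ = 𝟙 _ := F.map_id _
    have : IsIso (i ⊥) := by rw [this]; infer_instance
    exact (hP ⊥).isIso_inl_of_isIso
  rw [MorphismProperty.transfiniteCompositions_iff]
  exact ⟨J, inferInstance, inferInstance, inferInstance, inferInstance,
    ⟨{F := P
      isoBot := (asIso (inl ⊥)).symm
      incl := c.ι
      isColimit := hcc
      fac := hpl ⊥
      map_mem := fun j hj => MorphismProperty.of_isPushout (hP' _).flip (h.map_mem j hj) }⟩⟩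

end Transfinite

end ExactCat

/-! ### Attaching a small family of morphisms -/

namespace ExactCat

section MultiPushout

universe w

variable {C : Type u} [Category.{v} C] {Q : Type w} {A B : Q → C} (i : ∀ q, A q ⟶ B q) {X : C}
  (a : ∀ q, A q ⟶ X)

/-- `P` is obtained from `X` by attaching the morphisms `i q : A q ⟶ B q` along
`a q : A q ⟶ X` for all `q` in `s`. -/
structure IsMultiPushout (s : Set Q) {P : C} (f : X ⟶ P) (b : ∀ q ∈ s, B q ⟶ P) : Prop where
  w : ∀ q hq, i q ≫ b q hq = a q ≫ f
  exists_desc : ∀ {Z : C} (x : X ⟶ Z) (y : ∀ q ∈ s, B q ⟶ Z),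
    (∀ q hq, i q ≫ y q hq = a q ≫ x) →
    ∃ d : P ⟶ Z, f ≫ d = x ∧ ∀ q hq, b q hq ≫ d = y q hq
  hom_ext : ∀ {Z : C} {d d' : P ⟶ Z}, f ≫ d = f ≫ d' →
    (∀ q hq, b q hq ≫ d = b q hq ≫ d') → d = d'

variable {i a}

namespace IsMultiPushout

lemma isIso {s : Set Q} (hs : s = ∅) {P : C} {f : X ⟶ P} {b : ∀ q ∈ s, B q ⟶ P}
    (h : IsMultiPushout i a s f b) : IsIso f := by
  subst hs
  obtain ⟨d, hd, -⟩ := h.exists_desc (𝟙 X) (fun _ hq => hq.elim) (fun _ hq => hq.elim)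
  exact ⟨d, hd, h.hom_ext (by rw [reassoc_of% hd, Category.comp_id]) (fun _ hq => hq.elim)⟩

variable (i a) in
lemma empty : IsMultiPushout i a ∅ (𝟙 X) (fun _ hq => hq.elim) where
  w _ hq := hq.elim
  exists_desc x _ _ := ⟨x, by simp, fun _ hq => hq.elim⟩
  hom_ext h _ := by simpa using h

lemma exists_map {s s' : Set Q} (hs : s ⊆ s') {P P' : C} {f : X ⟶ P} {b : ∀ q ∈ s, B q ⟶ P}
    {f' : X ⟶ P'} {b' : ∀ q ∈ s', B q ⟶ P'} (h : IsMultiPushout i a s f b)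
    (h' : IsMultiPushout i a s' f' b') :
    ∃ d : P ⟶ P', f ≫ d = f' ∧ ∀ q hq, b q hq ≫ d = b' q (hs hq) :=
  h.exists_desc _ _ (fun q hq => h'.w q (hs hq))

/-- Attaching one more morphism is a pushout. -/
lemma isPushout {s s' : Set Q} {q : Q} (hq : q ∉ s) (hs' : s' = insert q s)
    {P P' : C} {f : X ⟶ P} {b : ∀ q ∈ s, B q ⟶ P}
    {f' : X ⟶ P'} {b' : ∀ q ∈ s', B q ⟶ P'} (h : IsMultiPushout i a s f b)
    (h' : IsMultiPushout i a s' f' b') {d : P ⟶ P'} (hd : f ≫ d = f')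
    (hd' : ∀ q hq, b q hq ≫ d = b' q (hs' ▸ Set.mem_insert_of_mem _ hq)) :
    IsPushout (a q ≫ f) (i q) d (b' q (hs' ▸ Set.mem_insert _ _)) := by
  classical
  subst hs'
  have hex {Z : C} (x : P ⟶ Z) (y : B q ⟶ Z) (hxy : (a q ≫ f) ≫ x = i q ≫ y) :
      ∃ l : P' ⟶ Z, d ≫ l = x ∧ b' q (Set.mem_insert _ _) ≫ l = y := by
    obtain ⟨l, hl, hl'⟩ := h'.exists_desc (f ≫ x)
      (fun q' hq' => if e : q' = q then eqToHom (by rw [e]) ≫ y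
        else b q' (Set.mem_of_mem_insert_of_ne hq' e) ≫ x) (by
          intro q' hq'
          split_ifs with e
          · subst e
            simpa using hxy.symm
          · rw [← Category.assoc, h.w, Category.assoc])
    refine ⟨l, h.hom_ext (by rw [reassoc_of% hd, hl]) (fun q' hq' => ?_), by simp [hl']⟩
    rw [reassoc_of% (hd' q' hq'), hl', dif_neg (ne_of_mem_of_not_mem hq' hq)]
  refine ⟨⟨?_⟩, ⟨PushoutCocone.IsColimit.mk _
    (fun s => (hex s.inl s.inr s.condition).choose)
    (fun s => (hex s.inl s.inr s.condition).choose_spec.1)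
    (fun s => (hex s.inl s.inr s.condition).choose_spec.2) ?_⟩⟩
  · rw [h'.w, Category.assoc, hd]
  · intro t m hm hm'
    have H := (hex t.inl t.inr t.condition).choose_spec
    refine h'.hom_ext ?_ ?_
    · rw [← hd, Category.assoc, Category.assoc, hm, H.1]
    · rintro q' (rfl | hq')
      · rw [hm', H.2]
      · rw [← hd' q' hq', Category.assoc, Category.assoc, hm, H.1]

lemma exists_insert {s : Set Q} {q : Q} (hq : q ∉ s) {P : C} {f : X ⟶ P}
    {b : ∀ q ∈ s, B q ⟶ P} (h : IsMultiPushout i a s f b) (hp : HasPushout (a q ≫ f) (i q)) :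
    ∃ (P' : C) (f' : X ⟶ P') (b' : ∀ q' ∈ insert q s, B q' ⟶ P'),
      IsMultiPushout i a (insert q s) f' b' := by
  classical
  refine ⟨pushout (a q ≫ f) (i q), f ≫ pushout.inl _ _, fun q' hq' =>
    if e : q' = q then eqToHom (by rw [e]) ≫ pushout.inr _ _
      else b q' (Set.mem_of_mem_insert_of_ne hq' e) ≫ pushout.inl _ _, ⟨?_, ?_, ?_⟩⟩
  · intro q' hq'
    split_ifs with e
    · subst e
      simpa using (pushout.condition (f := a q' ≫ f) (g := i q')).symm
    · rw [← Category.assoc, h.w, Category.assoc]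
  · intro Z x y hxy
    obtain ⟨d, hd, hd'⟩ := h.exists_desc x (fun q' hq' => y q' (Set.mem_insert_of_mem _ hq'))
      (fun q' hq' => hxy _ _)
    refine ⟨pushout.desc d (y q (Set.mem_insert _ _)) (by rw [Category.assoc, hd, hxy]),
      by rw [Category.assoc, pushout.inl_desc, hd], ?_⟩
    intro q' hq'
    split_ifs with e
    · subst e
      exact congr($(Category.id_comp _) ≫ _).trans (pushout.inr_desc _ _ _)
    · rw [Category.assoc, pushout.inl_desc, hd']
  · intro Z d d' hd hd'
    apply pushout.hom_ext
    · refine h.hom_ext (by simpa using hd) (fun q' hq' => ?_)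
      simpa [show q' ≠ q from fun e => hq (e ▸ hq')] using hd' q' (Set.mem_insert_of_mem _ hq')
    · simpa using hd' q (Set.mem_insert _ _)

section Chain

variable {K : Type*} [LinearOrder K] {σ : K → Set Q} (hσ : Monotone σ)
  {F : K ⥤ C} {f : ∀ k, X ⟶ F.obj k} {b : ∀ k, ∀ q ∈ σ k, B q ⟶ F.obj k}
  (h : ∀ k, IsMultiPushout i a (σ k) (f k) (b k))
  (hf : ∀ k k' (hk : k ≤ k'), f k ≫ F.map (homOfLE hk) = f k')
  (hb : ∀ k k' (hk : k ≤ k') q hq, b k q hq ≫ F.map (homOfLE hk) = b k' q (hσ hk hq))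
include h hf hb

lemma exists_of_isColimit [Nonempty K] {c : Cocone F} (hc : IsColimit c) {s : Set Q}
    (hs : s = ⋃ k, σ k) :
    ∃ (f' : X ⟶ c.pt) (b' : ∀ q ∈ s, B q ⟶ c.pt), IsMultiPushout i a s f' b' := by
  subst hs
  have k₀ : K := Classical.arbitrary K
  have hfc (k k' : K) : f k ≫ c.ι.app k = f k' ≫ c.ι.app k' := by
    wlog hk : k ≤ k'
    · exact (this hσ h hf hb hc k₀ k' k (le_of_not_ge hk)).symm
    rw [← hf k k' hk, Category.assoc, c.w]
  have hbc (k k' : K) (q : Q) (hq : q ∈ σ k) (hq' : q ∈ σ k') :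
      b k q hq ≫ c.ι.app k = b k' q hq' ≫ c.ι.app k' := by
    wlog hk : k ≤ k'
    · exact (this hσ h hf hb hc k₀ hfc k' k q hq' hq (le_of_not_ge hk)).symm
    rw [← hb k k' hk q hq, Category.assoc, c.w]
  have hmem (q : Q) (hq : q ∈ ⋃ k, σ k) : ∃ k, q ∈ σ k := Set.mem_iUnion.1 hq
  choose κ hκ using hmem
  refine ⟨f k₀ ≫ c.ι.app k₀, fun q hq => b _ q (hκ q hq) ≫ c.ι.app _, ⟨?_, ?_, ?_⟩⟩
  · intro q hq
    rw [← Category.assoc, (h _).w, Category.assoc, hfc _ k₀]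
  · intro Z x y hxy
    have hd (k : K) := (h k).exists_desc x (fun q hq => y q (Set.mem_iUnion.2 ⟨k, hq⟩))
      (fun q hq => hxy _ _)
    choose d hd hd' using hd
    let t : Cocone F :=
      { pt := Z
        ι :=
          { app := d
            naturality := fun k k' g => by
              refine Eq.trans ?_ (Category.comp_id _).symm
              have hfg : f k ≫ F.map g = f k' := hf k k' (leOfHom g)
              have hbg (q hq) : b k q hq ≫ F.map g = b k' q (hσ (leOfHom g) hq) :=
                hb k k' (leOfHom g) q hq
              refine (h k).hom_ext ?_ (fun q hq => ?_)
              · rw [reassoc_of% hfg, hd, hd]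
              · rw [reassoc_of% (hbg q hq), hd', hd'] } }
    refine ⟨hc.desc t, ?_, fun q hq => ?_⟩
    · rw [Category.assoc, hc.fac]; exact hd _
    · rw [Category.assoc, hc.fac]; exact hd' _ _ _
  · intro Z d d' hd hd'
    refine hc.hom_ext (fun k => (h k).hom_ext ?_ (fun q hq => ?_))
    · rw [reassoc_of% (hfc k k₀), reassoc_of% (hfc k k₀)]
      simpa using hd
    · have hq' : q ∈ ⋃ k, σ k := Set.mem_iUnion.2 ⟨k, hq⟩
      rw [reassoc_of% (hbc k _ q hq (hκ q hq')), reassoc_of% (hbc k _ q hq (hκ q hq'))]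
      simpa using hd' q hq'

lemma nonempty_isColimit [Nonempty K] {s : Set Q} (hs : ∀ q ∈ s, ∃ k, q ∈ σ k)
    (hs' : ∀ k, σ k ⊆ s)
    (c : Cocone F) {f' : X ⟶ c.pt} {b' : ∀ q ∈ s, B q ⟶ c.pt}
    (h' : IsMultiPushout i a s f' b')
    (hf' : ∀ k, f k ≫ c.ι.app k = f') (hb' : ∀ k q hq, b k q hq ≫ c.ι.app k = b' q (hs' k hq)) :
    Nonempty (IsColimit c) := by
  have k₀ : K := Classical.arbitrary K
  have hex (t : Cocone F) : ∃ d : c.pt ⟶ t.pt, ∀ k, c.ι.app k ≫ d = t.ι.app k := by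
    have hft (k k' : K) : f k ≫ t.ι.app k = f k' ≫ t.ι.app k' := by
      wlog hk : k ≤ k'
      · exact (this hσ h hf hb hs hs' c h' hf' hb' k₀ t k' k (le_of_not_ge hk)).symm
      rw [← hf k k' hk, Category.assoc, t.w]
    have hbt (k k' : K) (q : Q) (hq : q ∈ σ k) (hq' : q ∈ σ k') :
        b k q hq ≫ t.ι.app k = b k' q hq' ≫ t.ι.app k' := by
      wlog hk : k ≤ k'
      · exact (this hσ h hf hb hs hs' c h' hf' hb' k₀ t hft k' k q hq' hq (le_of_not_ge hk)).symm
      rw [← hb k k' hk q hq, Category.assoc, t.w]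
    choose κ hκ using hs
    obtain ⟨d, hd, hd'⟩ := h'.exists_desc (f k₀ ≫ t.ι.app k₀)
      (fun q hq => b _ q (hκ q hq) ≫ t.ι.app _) (fun q hq => by
        rw [← Category.assoc, (h _).w, Category.assoc, hft _ k₀])
    refine ⟨d, fun k => (h k).hom_ext ?_ (fun q hq => ?_)⟩
    · rw [reassoc_of% (hf' k), hd, hft]
    · rw [reassoc_of% (hb' k q hq), hd', hbt]
  refine ⟨⟨fun t => (hex t).choose, fun t => (hex t).choose_spec, fun t m hm => ?_⟩⟩
  have H := (hex t).choose_spec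
  refine h'.hom_ext ?_ (fun q hq => ?_)
  · rw [← hf' k₀, Category.assoc, Category.assoc, hm, H]
  · obtain ⟨k, hk⟩ := hs q hq
    rw [← hb' k q hk, Category.assoc, Category.assoc, hm, H]

end Chain

end IsMultiPushout

/-- Transition maps are determined by their effect on `X` and on the cells `B q`, so independently
chosen ones are automatically functorial. -/
lemma exists_functor_of_isMultiPushout {K : Type*} [LinearOrder K] {σ : K → Set Q}
    (hσ : Monotone σ) {P : K → C} {f : ∀ k, X ⟶ P k} {b : ∀ k, ∀ q ∈ σ k, B q ⟶ P k}
    (h : ∀ k, IsMultiPushout i a (σ k) (f k) (b k)) :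
    ∃ (map : ∀ {k k'} (_ : k ⟶ k'), P k ⟶ P k') (_ : ∀ k, map (𝟙 k) = 𝟙 (P k))
      (_ : ∀ {k k' k''} (g : k ⟶ k') (g' : k' ⟶ k''), map (g ≫ g') = map g ≫ map g'),
      (∀ {k k'} (g : k ⟶ k'), f k ≫ map g = f k') ∧
      ∀ {k k'} (g : k ⟶ k') q hq, b k q hq ≫ map g = b k' q (hσ (leOfHom g) hq) := by
  have H (k k' : K) (g : k ⟶ k') := (h k).exists_map (hσ (leOfHom g)) (h k')
  choose map hf hb using H
  refine ⟨fun g => map _ _ g, fun k => (h k).hom_ext ?_ fun q hq => ?_,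
    fun g g' => (h _).hom_ext ?_ fun q hq => ?_, fun g => hf _ _ g, fun g => hb _ _ g⟩
  · rw [hf, Category.comp_id]
  · rw [hb, Category.comp_id]
  · rw [hf, reassoc_of% hf, hf]
  · rw [hb, ← Category.assoc, hb, hb]

/-- A family of multipushouts indexed by a well-ordered chain of sets, growing by one element at
each successor step, forms a continuous chain of pushouts of the morphisms `i q`. -/
lemma exists_chain_of_isMultiPushout {W : MorphismProperty C} [W.IsStableUnderCobaseChange]
    (hi : ∀ q, W (i q)) {K : Type*} [LinearOrder K] {σ : K → Set Q} (hσ : Monotone σ)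
    (hsucc : ∀ k k', k ⋖ k' → ∃ q, q ∉ σ k ∧ σ k' = insert q (σ k))
    (hlim : ∀ k, Order.IsSuccPrelimit k → ∀ q ∈ σ k, ∃ k' < k, q ∈ σ k')
    {P : K → C} {f : ∀ k, X ⟶ P k} {b : ∀ k, ∀ q ∈ σ k, B q ⟶ P k}
    (h : ∀ k, IsMultiPushout i a (σ k) (f k) (b k)) :
    ∃ (F : K ⥤ C) (f : ∀ k, X ⟶ F.obj k) (b : ∀ k, ∀ q ∈ σ k, B q ⟶ F.obj k),
      F.IsWellOrderContinuous ∧ (∀ k, IsMultiPushout i a (σ k) (f k) (b k)) ∧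
      (∀ k k' (g : k ⟶ k'), f k ≫ F.map g = f k') ∧
      (∀ k k' (g : k ⟶ k') q hq, b k q hq ≫ F.map g = b k' q (hσ (leOfHom g) hq)) ∧
      ∀ k k' (g : k ⟶ k'), k ⋖ k' → W (F.map g) := by
  obtain ⟨map, h₁, h₂, hf, hb⟩ := exists_functor_of_isMultiPushout hσ h
  let F : K ⥤ C := { obj := P, map := map, map_id := h₁, map_comp := h₂ }
  refine ⟨F, f, b, ⟨fun m hm => ?_⟩, h, fun _ _ g => hf g, fun _ _ g => hb g, ?_⟩
  · have : Nonempty (Set.Iio m) := by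
      obtain ⟨x, hx⟩ := not_isMin_iff.1 hm.1
      exact ⟨⟨x, hx⟩⟩
    refine IsMultiPushout.nonempty_isColimit (K := Set.Iio m) (σ := fun k => σ k.1)
      (f := fun k => f k.1) (b := fun k => b k.1)
      (fun _ _ hk => hσ hk) (fun k => h k.1) (fun _ _ hk => hf _) (fun _ _ hk => hb _)
      (fun q hq => ?_) (fun k => hσ k.2.le) _ (h m) (fun k => hf _) (fun k => hb _)
    obtain ⟨k', hk', hq'⟩ := hlim m hm.2 q hq
    exact ⟨⟨k', hk'⟩, hq'⟩
  · intro k k' g hk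
    obtain ⟨q, hq, hs⟩ := hsucc k k' hk
    exact MorphismProperty.of_isPushout ((h k).isPushout hq hs (h k') (hf g) (hb g)) (hi q)

variable (i a)

/-- Existence of multipushouts for a well-ordered chain of sets. -/
theorem exists_isMultiPushout_of_chain {W : MorphismProperty C} [W.IsStableUnderCobaseChange]
    (hpush : ∀ ⦃A B X : C⦄ (i : A ⟶ B) (t : A ⟶ X), W i → HasPushout t i)
    (hcolim : ∀ (J : Type w) [LinearOrder J] [SuccOrder J] [OrderBot J] [WellFoundedLT J]
      (F : J ⥤ C) [F.IsWellOrderContinuous],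
      (∀ j : J, ¬ IsMax j → W (F.map (homOfLE (Order.le_succ j)))) → HasColimit F)
    (hi : ∀ q, W (i q)) {K : Type w} [LinearOrder K] [OrderBot K] [WellFoundedLT K]
    {σ : K → Set Q} (hσ : Monotone σ) (hbot : σ ⊥ = ∅)
    (hsucc : ∀ k k', k ⋖ k' → ∃ q, q ∉ σ k ∧ σ k' = insert q (σ k))
    (hlim : ∀ k, Order.IsSuccPrelimit k → ∀ q ∈ σ k, ∃ k' < k, q ∈ σ k') (k : K) :
    ∃ (P : C) (f : X ⟶ P) (b : ∀ q ∈ σ k, B q ⟶ P), IsMultiPushout i a (σ k) f b := by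
  induction k using WellFoundedLT.induction with | _ k ih
  by_cases hk : Order.IsSuccPrelimit k
  · by_cases hk' : IsMin k
    · obtain rfl := hk'.eq_bot
      rw [hbot]
      exact ⟨_, _, _, IsMultiPushout.empty i a⟩
    · have hbk : ⊥ < k := bot_lt_iff_ne_bot.2 (fun h => hk' (h ▸ isMin_bot))
      let _ : OrderBot (Set.Iio k) := { bot := ⟨⊥, hbk⟩, bot_le := fun _ => bot_le (α := K) }
      let _ : SuccOrder (Set.Iio k) := SuccOrder.ofLinearWellFoundedLT _
      choose P f b h using fun (x : Set.Iio k) => ih x.1 x.2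
      have hcov (x y : Set.Iio k) (hxy : x ⋖ y) : x.1 ⋖ y.1 :=
        ⟨hxy.1, fun z hz hz' => hxy.2 (c := ⟨z, hz'.trans y.2⟩) hz hz'⟩
      have hcov' (x : K) (y : Set.Iio k) (hxy : x ⋖ y.1) :
          (⟨x, hxy.1.trans y.2⟩ : Set.Iio k) ⋖ y :=
        ⟨hxy.1, fun z hz hz' => hxy.2 (c := z.1) hz hz'⟩
      -- At a limit `k` the stages chosen below `k` form a continuous chain with steps in `W`. Its
      -- colimit exists by `hcolim` and is the multipushout for the union of the sets below `k`,
      -- namely `σ k`.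
      obtain ⟨F, f, b, hF, h, hf, hb, hW⟩ := exists_chain_of_isMultiPushout hi
        (σ := fun x : Set.Iio k => σ x.1) (fun _ _ hx => hσ hx)
        (fun x y hxy => hsucc _ _ (hcov x y hxy))
        (fun x hx q hq => by
          obtain ⟨y, hy, hq'⟩ := hlim x.1 (fun z hz => hx _ (hcov' _ _ hz)) q hq
          exact ⟨⟨y, hy.trans x.2⟩, hy, hq'⟩) h
      have := hcolim (Set.Iio k) F
        (fun j hj => hW _ _ _ (Order.covBy_succ_of_not_isMax hj))
      have : Nonempty (Set.Iio k) := ⟨⊥⟩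
      obtain ⟨f', b', h'⟩ := IsMultiPushout.exists_of_isColimit (σ := fun x : Set.Iio k => σ x.1)
        (fun _ _ hx => hσ hx) h
        (fun _ _ _ => hf _ _ _) (fun _ _ _ => hb _ _ _) (colimit.isColimit F) (s := σ k) (by
          apply le_antisymm
          · intro q hq
            obtain ⟨x, hx, hq⟩ := hlim k hk q hq
            exact Set.mem_iUnion.2 ⟨⟨x, hx⟩, hq⟩
          · exact Set.iUnion_subset (fun x => hσ x.2.le))
      exact ⟨_, f', b', h'⟩
  · obtain ⟨x, hx⟩ := Order.not_isSuccPrelimit_iff.1 hk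
    obtain ⟨q, hq, hs⟩ := hsucc _ _ hx
    obtain ⟨P, f, b, h⟩ := ih x hx.1
    rw [hs]
    exact h.exists_insert hq (hpush _ _ (hi q))

/-- Attaching a small family of morphisms of `W` gives a transfinite composition of pushouts of
these morphisms. -/
theorem exists_isMultiPushout {W : MorphismProperty C} [W.IsStableUnderCobaseChange]
    (hpush : ∀ ⦃A B X : C⦄ (i : A ⟶ B) (t : A ⟶ X), W i → HasPushout t i)
    (hcolim : ∀ (J : Type w) [LinearOrder J] [SuccOrder J] [OrderBot J] [WellFoundedLT J]
      (F : J ⥤ C) [F.IsWellOrderContinuous],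
      (∀ j : J, ¬ IsMax j → W (F.map (homOfLE (Order.le_succ j)))) → HasColimit F)
    (hi : ∀ q, W (i q)) :
    ∃ (P : C) (f : X ⟶ P) (b : ∀ q ∈ Set.univ, B q ⟶ P),
      MorphismProperty.transfiniteCompositions.{w} W f ∧
      IsMultiPushout i a Set.univ f b := by
  obtain ⟨_, _⟩ := exists_wellFoundedLT Q
  -- For a well-order on `Q`, stage `k` has attached the cells strictly below `k`: each successor
  -- step adds one cell. The extra element `⊤` is the stage where all are attached, so the colimit
  -- of the chain is its value at `⊤`.
  let K := WithTop Q
  let _ : OrderBot K := WellFoundedLT.toOrderBot K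
  let _ : SuccOrder K := SuccOrder.ofLinearWellFoundedLT K
  let σ (k : K) : Set Q := {q | (q : WithTop Q) < k}
  have hσ : Monotone σ := fun k k' h q hq => lt_of_lt_of_le hq h
  have hbot : σ ⊥ = ∅ := Set.eq_empty_of_forall_notMem fun q hq => not_lt_bot (α := K) hq
  have hsucc (k k' : K) (h : k ⋖ k') : ∃ q, q ∉ σ k ∧ σ k' = insert q (σ k) := by
    obtain ⟨q, rfl⟩ := WithTop.ne_top_iff_exists.1 (ne_top_of_lt h.1)
    refine ⟨q, lt_irrefl (q : WithTop Q), ?_⟩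
    ext q'
    constructor
    · intro hq'
      rcases lt_trichotomy (q' : WithTop Q) q with h' | h' | h'
      · exact Or.inr h'
      · exact Or.inl (WithTop.coe_injective h')
      · exact (h.2 h' hq').elim
    · rintro (rfl | hq')
      · exact h.1
      · exact lt_trans (show (q' : WithTop Q) < q from hq') h.1
  have hlim (k : K) (hk : Order.IsSuccPrelimit k) (q : Q) (hq : q ∈ σ k) :
      ∃ k' < k, q ∈ σ k' := by
    have := hk q
    rw [not_covBy_iff hq] at this
    obtain ⟨c, hc, hc'⟩ := this
    exact ⟨c, hc', hc⟩
  choose P f b h using exists_isMultiPushout_of_chain i a hpush hcolim hi hσ hbot hsucc hlim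
  obtain ⟨F, f, b, hF, h, hf, hb, hW⟩ := exists_chain_of_isMultiPushout hi hσ hsucc hlim h
  have htop : σ ⊤ = Set.univ := Set.eq_univ_of_forall (fun q => WithTop.coe_lt_top q)
  have := (h ⊥).isIso hbot
  have hfin : ∀ s, σ ⊤ = s → ∃ b' : ∀ q ∈ s, B q ⟶ F.obj ⊤, IsMultiPushout i a s (f ⊤) b' := by
    rintro _ rfl
    exact ⟨_, h ⊤⟩
  obtain ⟨b', h'⟩ := hfin _ htop
  refine ⟨F.obj ⊤, f ⊤, b', ?_, h'⟩
  rw [MorphismProperty.transfiniteCompositions_iff]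
  exact ⟨K, inferInstance, inferInstance, inferInstance, inferInstance,
    ⟨{F := F
      isoBot := (asIso (f ⊥)).symm
      incl := (coconeOfDiagramTerminal isTerminalTop F).ι
      isColimit := colimitOfDiagramTerminal isTerminalTop F
      fac := hf _ _ _
      map_mem := fun j hj => hW _ _ _ (Order.covBy_succ_of_not_isMax hj) }⟩⟩

end MultiPushout

end ExactCat

/-! ### Transfinite iteration without cocompleteness -/

namespace ExactCat

section Iteration

variable {C : Type u} [Category.{v} C]

/-- The fully faithful functor, preserving colimits, from a category to the opposite of the
category of its copresheaves. -/
abbrev coyonedaOp (C : Type u) [Category.{v} C] : C ⥤ (C ⥤ Type v)ᵒᵖ := coyoneda.rightOp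

lemma preservesColimitsOfShape_coyonedaOp (K : Type v) [Category.{v} K] :
    PreservesColimitsOfShape K (coyonedaOp C) :=
  preservesColimitsOfShape_rightOp _ _

/-- A continuous chain of representable objects comes from a continuous chain. -/
lemma exists_lift_chain {K : Type v} [LinearOrder K] (H : K ⥤ (C ⥤ Type v)ᵒᵖ)
    [H.IsWellOrderContinuous] (hH : ∀ k, (coyonedaOp C).essImage (H.obj k)) :
    ∃ F : K ⥤ C, F.IsWellOrderContinuous ∧ Nonempty (F ⋙ coyonedaOp C ≅ H) := by
  let F := Functor.essImage.liftFunctor H (coyonedaOp C) hH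
  let α : F ⋙ coyonedaOp C ≅ H := Functor.essImage.liftFunctorCompIso H (coyonedaOp C) hH
  refine ⟨F, ⟨fun m hm => ?_⟩, ⟨α⟩⟩
  have := Functor.isWellOrderContinuous_of_iso α.symm
  have h := (F ⋙ coyonedaOp C).isColimitOfIsWellOrderContinuous m hm
  have h' : IsColimit ((coyonedaOp C).mapCocone ((Set.principalSegIio m).cocone F)) :=
    IsColimit.ofIsoColimit h (Cocone.ext (Iso.refl _) (fun j => Category.comp_id _))
  exact ⟨isColimitOfReflects (coyonedaOp C) h'⟩

/-- Transfinite iteration of a (nonfunctorial) choice of morphisms `X ⟶ succ X` in a class `W`,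
assuming only the existence of colimits of chains of morphisms of `W`. -/
theorem exists_iteration (W : MorphismProperty C) [W.RespectsIso]
    (hcolim : ∀ (J : Type v) [LinearOrder J] [SuccOrder J] [OrderBot J] [WellFoundedLT J]
      (F : J ⥤ C) [F.IsWellOrderContinuous],
      (∀ j : J, ¬ IsMax j → W (F.map (homOfLE (Order.le_succ j)))) → HasColimit F)
    (succ : C → C) (toSucc : ∀ X, X ⟶ succ X) (hW : ∀ X, W (toSucc X)) (X₀ : C)
    (J : Type v) [LinearOrder J] [SuccOrder J] [OrderBot J] [WellFoundedLT J] :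
    ∃ F : J ⥤ C, F.IsWellOrderContinuous ∧ Nonempty (F.obj ⊥ ≅ X₀) ∧
      ∀ j : J, ¬ IsMax j → ∃ X, Nonempty
        (Arrow.mk (F.map (homOfLE (Order.le_succ j))) ≅ Arrow.mk (toSucc X)) := by
  classical
  -- The iteration takes place in the cocomplete category `(C ⥤ Type v)ᵒᵖ`, where `toSucc` is
  -- transported to the representable objects and is an identity, up to `eqToHom`, elsewhere. It
  -- remains to see that every stage is representable.
  let Y := coyonedaOp C
  let Φ : SmallObject.SuccStruct (C ⥤ Type v)ᵒᵖ :=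
    { X₀ := Y.obj X₀
      succ := fun d => if h : Y.essImage d then Y.obj (succ h.witness) else d
      toSucc := fun d => if h : Y.essImage d then
        h.getIso.inv ≫ Y.map (toSucc h.witness) ≫ eqToHom (by rw [dif_pos h])
        else eqToHom (by rw [dif_neg h]) }
  let H := Φ.iterationFunctor J
  have hΦ (d) (hd : Y.essImage d) :
      ∃ X, Nonempty (Arrow.mk (Φ.toSucc d) ≅ Arrow.mk (Y.map (toSucc X))) := by
    have h : Y.obj (succ hd.witness) = Φ.succ d := by simp only [Φ, dif_pos hd]
    refine ⟨hd.witness, ⟨(Arrow.isoMk hd.getIso (eqToIso h) ?_).symm⟩⟩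
    simp [Φ, hd]
  have hstep (j : J) (hj : ¬ IsMax j) (hd : Y.essImage (H.obj j)) :
      ∃ X, Nonempty (Arrow.mk (H.map (homOfLE (Order.le_succ j))) ≅
        Arrow.mk (Y.map (toSucc X))) := by
    obtain ⟨X, ⟨e⟩⟩ := hΦ _ hd
    refine ⟨X, ⟨?_ ≪≫ e⟩⟩
    refine Arrow.isoMk (Iso.refl _) (Φ.iterationFunctorObjSuccIso j hj) ?_
    have := Φ.iterationFunctor_map_succ j hj
    simp [H, this]
  have hlift {K : Type v} [LinearOrder K] (s : K → J) (hs : Monotone s)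
      (F : K ⥤ C) (α : F ⋙ Y ≅ hs.functor ⋙ H)
      (hess : ∀ k, Y.essImage (H.obj (s k))) (k k' : K) (g : k ⟶ k') (hk : s k ⋖ s k') :
      ∃ X, Nonempty (Arrow.mk (F.map g) ≅ Arrow.mk (toSucc X)) := by
    obtain ⟨X, ⟨e⟩⟩ := hstep (s k) hk.1.not_isMax (hess k)
    have hs' : Order.succ (s k) = s k' := hk.succ_eq
    have e₁ : Arrow.mk (Y.map (F.map g)) ≅ Arrow.mk (H.map (homOfLE (Order.le_succ (s k)))) :=
      Arrow.isoMk (α.app k) (α.app k' ≪≫ H.mapIso (eqToIso hs'.symm)) (by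
        refine Eq.trans ?_ (congr($(α.hom.naturality g) ≫ _).trans (Category.assoc _ _ _)).symm
        refine congr(_ ≫ $(?_))
        exact H.map_comp (homOfLE hk.1.le) (homOfLE hs'.ge))
    have e₂ := e₁ ≪≫ e
    refine ⟨X, ⟨Arrow.isoMk (Y.preimageIso ((Arrow.leftFunc.mapIso e₂)))
      (Y.preimageIso ((Arrow.rightFunc.mapIso e₂))) (Y.map_injective ?_)⟩⟩
    have h₁ : Y.map (Y.preimageIso (Arrow.leftFunc.mapIso e₂)).hom = e₂.hom.left :=
      Y.map_preimage _
    have h₂ : Y.map (Y.preimageIso (Arrow.rightFunc.mapIso e₂)).hom = e₂.hom.right :=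
      Y.map_preimage _
    rw [Functor.map_comp, Functor.map_comp, h₁, h₂]
    exact Arrow.w e₂.hom
  have hess (j : J) : Y.essImage (H.obj j) := by
    induction j using SuccOrder.limitRecOn with
    | isMin j hj =>
      obtain rfl := hj.eq_bot
      exact ⟨X₀, ⟨(Φ.iterationFunctorObjBotIso J).symm⟩⟩
    | succ j hj ih =>
      obtain ⟨X, ⟨e⟩⟩ := hstep j hj ih
      exact ⟨succ X, ⟨(Arrow.rightFunc.mapIso e).symm⟩⟩
    -- The stages below `m` lift to a continuous chain in `C` with steps in `W`. Its colimit exists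
    -- by `hcolim` and is preserved by `Y`, so stage `m` is representable.
    | isSuccLimit m hm ih =>
      let _ : OrderBot (Set.Iio m) := { bot := ⟨⊥, hm.bot_lt⟩, bot_le := fun _ => bot_le (α := J) }
      let _ : SuccOrder (Set.Iio m) := SuccOrder.ofLinearWellFoundedLT _
      let H' : Set.Iio m ⥤ (C ⥤ Type v)ᵒᵖ := (Set.principalSegIio m).monotone.functor ⋙ H
      have : H'.IsWellOrderContinuous :=
        inferInstanceAs (((Set.principalSegIio m : Set.Iio m ≤i J).monotone.functor ⋙
          H).IsWellOrderContinuous)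
      obtain ⟨F, hF, ⟨α⟩⟩ := exists_lift_chain H' (fun k => ih k.1 k.2)
      have : HasColimit F := hcolim _ F (fun j hj => by
        obtain ⟨X, ⟨e⟩⟩ := hlift (fun x : Set.Iio m => x.1)
          (Set.principalSegIio m).monotone F α (fun k => ih k.1 k.2) j (Order.succ j)
          (homOfLE (Order.le_succ j)) (by
            have hcov := Order.covBy_succ_of_not_isMax hj
            exact ⟨hcov.1, fun z hz hz' => hcov.2 (c := ⟨z, hz'.trans (Order.succ j).2⟩) hz hz'⟩)
        exact (W.arrow_mk_iso_iff e).2 (hW X))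
      have := preservesColimitsOfShape_coyonedaOp (C := C) (Set.Iio m)
      have h₁ := isColimitOfPreserves Y (colimit.isColimit F)
      have h₂ := H.isColimitOfIsWellOrderContinuous m hm
      exact ⟨colimit F, ⟨h₁.coconePointsIsoOfNatIso h₂ α⟩⟩
  obtain ⟨F, hF, ⟨α⟩⟩ := exists_lift_chain H hess
  refine ⟨F, hF, ⟨Y.preimageIso (α.app ⊥ ≪≫ Φ.iterationFunctorObjBotIso J)⟩, fun j hj => ?_⟩
  exact hlift id monotone_id F α hess j (Order.succ j) _ (Order.covBy_succ_of_not_isMax hj)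

end Iteration

end ExactCat

/-! ### The small object argument -/

namespace ExactCat

/-- The forgetful functor is only known to preserve a colimit when the underlying diagram has one.
Well-founded induction supplies this: continuity below `m` makes the underlying chain below `m`
continuous, and then `h` gives its colimit. -/
lemma isWellOrderContinuous_comp_forget {C : Type u} [Category.{v} C] {Y : C} {J : Type v}
    [LinearOrder J] [SuccOrder J] [OrderBot J] [WellFoundedLT J] (F : J ⥤ Over Y)
    [F.IsWellOrderContinuous]
    (h : ∀ (m : J), Order.IsSuccLimit m →
      ((Set.principalSegIio m).monotone.functor ⋙ F ⋙ Over.forget Y).IsWellOrderContinuous →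
      HasColimit (((Set.principalSegIio m).monotone.functor ⋙ F) ⋙ Over.forget Y)) :
    (F ⋙ Over.forget Y).IsWellOrderContinuous := by
  have key (m : J) (hm : Order.IsSuccLimit m) :
      Nonempty (IsColimit ((Set.principalSegIio m).cocone (F ⋙ Over.forget Y))) := by
    induction m using WellFoundedLT.induction with | _ m ih
    have := h m hm ⟨fun x hx => by
      have hx' : Order.IsSuccLimit x.1 :=
        ⟨fun hx' => hx.1 (fun y hy => hx' (b := y.1) hy), fun y hy => hx.2 ⟨y, hy.1.trans x.2⟩
          ⟨hy.1, fun z hz hz' => hy.2 (c := z.1) hz hz'⟩⟩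
      refine nonempty_isColimit_of_cofinal
        (s := fun y : Set.Iio x.1 => (⟨⟨y.1, y.2.trans x.2⟩, y.2⟩ : Set.Iio x)) (fun _ _ h => h)
        (fun y => ⟨⟨y.1.1, y.2⟩, le_rfl⟩) (fun y => Iso.refl _) ?_
        (ih x.1 x.2 hx').some _ (Iso.refl _) ?_
      · intro y y' hy
        exact (Category.comp_id _).trans (Category.id_comp _).symm
      · intro y
        exact (Category.comp_id _).trans (Category.id_comp _).symm⟩
    exact ⟨isColimitOfPreserves (Over.forget Y) (F.isColimitOfIsWellOrderContinuous m hm)⟩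
  exact ⟨fun m hm => key m hm⟩

namespace ExactStructure

variable {C : Type u} [Category.{v} C] [Preadditive C] [HasZeroObject C]
  [HasBinaryBiproducts C] {E : ExactStructure C}

lemma inflations_le_monomorphisms : E.inflations ≤ MorphismProperty.monomorphisms C :=
  fun _ _ _ h => mono_of_inflation h

namespace IsEfficient

variable (hE : E.IsEfficient)
include hE

lemma transfiniteCompositions_le (S : ObjectProperty C) :
    (E.inflationsWithCokernelIn S).transfiniteCompositions.{v} ≤ E.inflations := by
  have := hE.transfinite
  exact (MorphismProperty.transfiniteCompositions_le_iff).2 (inflationsWithCokernelIn_le S)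

lemma isStableUnderTransfiniteComposition (S : ObjectProperty C) :
    MorphismProperty.IsStableUnderTransfiniteComposition.{v}
      ((E.inflationsWithCokernelIn S).transfiniteCompositions.{v}) := by
  have := hE.transfinite
  exact isStableUnderTransfiniteComposition_transfiniteCompositions _ E.inflations
    (inflationsWithCokernelIn_le S) inflations_le_monomorphisms

lemma transfiniteCompositions_of_isPushout (S : ObjectProperty C) {X Y X' Y' : C} {f : X ⟶ Y}
    {t : X ⟶ X'} {f' : X' ⟶ Y'} {b : Y ⟶ Y'} (sq : IsPushout t f f' b)
    (hf : (E.inflationsWithCokernelIn S).transfiniteCompositions.{v} f) :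
    (E.inflationsWithCokernelIn S).transfiniteCompositions.{v} f' := by
  have := hE.transfinite
  exact ExactCat.transfiniteCompositions_of_isPushout _ E.inflations
    (inflationsWithCokernelIn_le S) (fun _ _ _ i t hi => hasPushout_of_inflation i t hi) sq hf

lemma hasColimit_of_le {W : MorphismProperty C} (hW : W ≤ E.inflations) (J : Type v)
    [LinearOrder J] [SuccOrder J] [OrderBot J] [WellFoundedLT J] (F : J ⥤ C)
    [F.IsWellOrderContinuous]
    (hF : ∀ j : J, ¬ IsMax j → W (F.map (homOfLE (Order.le_succ j)))) : HasColimit F :=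
  hE.hasColimit J F (fun j hj => hW _ (hF j hj))

/-- One step of the small object argument. -/
lemma exists_attach (S : ObjectProperty C) {ι : Type v} {A B : ι → C} (i : ∀ k, A k ⟶ B k)
    (hi : ∀ k, E.inflationsWithCokernelIn S (i k)) {X Y : C} (g : X ⟶ Y) :
    ∃ (P : C) (j : X ⟶ P) (p : P ⟶ Y),
      (E.inflationsWithCokernelIn S).transfiniteCompositions.{v} j ∧ j ≫ p = g ∧
      ∀ k (x : A k ⟶ X) (y : B k ⟶ Y), x ≫ g = i k ≫ y →
        ∃ l : B k ⟶ P, i k ≫ l = x ≫ j ∧ l ≫ p = y := by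
  -- One cell for each commutative square from some `i k` to `g`.
  let Q : Type v := Σ k, {xy : (A k ⟶ X) × (B k ⟶ Y) // xy.1 ≫ g = i k ≫ xy.2}
  obtain ⟨P, j, b, hj, h⟩ := exists_isMultiPushout (Q := Q) (fun q => i q.1) (fun q => q.2.1.1)
    (W := E.inflationsWithCokernelIn S)
    (fun _ _ _ i t hi => hasPushout_of_inflation i t (inflationsWithCokernelIn_le S _ hi))
    (hE.hasColimit_of_le (inflationsWithCokernelIn_le S)) (fun q => hi _)
  obtain ⟨p, hp, hp'⟩ := h.exists_desc g (fun q _ => q.2.1.2) (fun q _ => q.2.2.symm)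
  refine ⟨P, j, p, hj, hp, fun k x y hxy => ?_⟩
  let q : Q := ⟨k, (x, y), hxy⟩
  exact ⟨b q trivial, h.w q trivial, hp' q trivial⟩

/-- Any infinite successor cardinal above all the individual smallness bounds will do, since
successors of infinite cardinals are regular. -/
lemma exists_regular {ι : Type v} (A : ι → C) :
    ∃ κ : Cardinal.{v}, κ.IsRegular ∧
      ∀ k, ∃ κ' ≤ κ, IsSmallRelative κ' E.inflations (A k) := by
  choose κ _ hκ using fun k => hE.small (A k)
  refine ⟨Order.succ (max Cardinal.aleph0 (⨆ k, κ k)),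
    Cardinal.isRegular_succ (le_max_left _ _), fun k => ⟨κ k, ?_, hκ k⟩⟩
  exact (le_ciSup (Cardinal.bddAbove_of_small) k).trans
    ((le_max_right _ _).trans (Order.le_succ _))

/-- The small object argument. -/
theorem exists_factorization (S : ObjectProperty C) {ι : Type v} {A B : ι → C}
    (i : ∀ k, A k ⟶ B k) (hi : ∀ k, E.inflationsWithCokernelIn S (i k)) {X Y : C} (g : X ⟶ Y) :
    ∃ (P : C) (j : X ⟶ P) (p : P ⟶ Y),
      (E.inflationsWithCokernelIn S).transfiniteCompositions.{v} j ∧ j ≫ p = g ∧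
      ∀ k, HasLiftingProperty (i k) p := by
  obtain ⟨κ, hκ, hA⟩ := hE.exists_regular A
  let J := κ.ord.ToType
  have : NoMaxOrder J := Cardinal.noMaxOrder hκ.aleph0_le
  have : Nonempty J := Ordinal.nonempty_toType_iff.2 (by
    rw [ne_eq, Cardinal.ord_eq_zero]; exact hκ.pos.ne')
  let _ : OrderBot J := WellFoundedLT.toOrderBot J
  let _ : SuccOrder J := SuccOrder.ofLinearWellFoundedLT J
  have hcof : κ ≤ Order.cof J := by
    rw [Ordinal.cof_toType, hκ.cof_ord]
  let W := (E.inflationsWithCokernelIn S).transfiniteCompositions.{v}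
  have hWM : W ≤ E.inflations := hE.transfiniteCompositions_le S
  have := hE.isStableUnderTransfiniteComposition S
  -- Besides lying in `W`, a step must solve every lifting problem posed at its source. Packaging
  -- both conditions as a class of morphisms of `Over Y` that respects isomorphisms is needed
  -- because `exists_iteration` describes the steps only up to isomorphism.
  let W' : MorphismProperty (Over Y) := fun Z Z' φ => W φ.left ∧
    ∀ k (x : A k ⟶ Z.left) (y : B k ⟶ Y), x ≫ Z.hom = i k ≫ y →
      ∃ l : B k ⟶ Z'.left, i k ≫ l = x ≫ φ.left ∧ l ≫ Z'.hom = y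
  have hW' : W'.RespectsIso := MorphismProperty.RespectsIso.of_respects_arrow_iso _ (by
    rintro φ ψ e ⟨h₁, h₂⟩
    refine ⟨(W.arrow_mk_iso_iff ((Over.forget Y).mapArrow.mapIso e)).1 h₁, fun k x y hxy => ?_⟩
    have e₁ : e.inv.left ≫ φ.hom = ψ.hom ≫ e.inv.right := Arrow.w e.inv
    have e₂ : e.hom.left ≫ ψ.hom = φ.hom ≫ e.hom.right := Arrow.w e.hom
    obtain ⟨l, hl, hl'⟩ := h₂ k (x ≫ e.inv.left.left) y (by
      rw [Category.assoc]
      exact congr(x ≫ $(Over.w e.inv.left)).trans hxy)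
    refine ⟨l ≫ e.hom.right.left, ?_, ?_⟩
    · rw [reassoc_of% hl]
      have h₃ : e.inv.left ≫ φ.hom ≫ e.hom.right = ψ.hom := by
        rw [← e₂, Arrow.inv_hom_id_left_assoc]
      exact congr(x ≫ ($h₃).left)
    · rw [Category.assoc]
      exact congr(l ≫ $(Over.w e.hom.right)).trans hl')
  have hcont (K : Type v) [LinearOrder K] [SuccOrder K] [OrderBot K] [WellFoundedLT K]
      (F : K ⥤ Over Y) [F.IsWellOrderContinuous]
      (hF : ∀ j : K, ¬ IsMax j → W' (F.map (homOfLE (Order.le_succ j)))) :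
      (F ⋙ Over.forget Y).IsWellOrderContinuous := by
    refine isWellOrderContinuous_comp_forget F (fun m hm hcm => ?_)
    let _ : OrderBot (Set.Iio m) := { bot := ⟨⊥, hm.bot_lt⟩, bot_le := fun _ => bot_le (α := K) }
    let _ : SuccOrder (Set.Iio m) := SuccOrder.ofLinearWellFoundedLT _
    refine hE.hasColimit_of_le hWM (Set.Iio m)
      ((Set.principalSegIio m).monotone.functor ⋙ F ⋙ Over.forget Y) (fun j hj => ?_)
    have hcov := Order.covBy_succ_of_not_isMax hj
    have hcov' : j.1 ⋖ (Order.succ j).1 :=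
      ⟨hcov.1, fun z hz hz' => hcov.2 (c := ⟨z, hz'.trans (Order.succ j).2⟩) hz hz'⟩
    have h₁ := (hF j.1 hcov'.1.not_isMax).1
    have h₂ (x : K) (hx : Order.succ j.1 = x) (hjx : j.1 ≤ x) :
        W (F.map (homOfLE hjx)).left := by
      subst hx; exact h₁
    exact h₂ _ hcov'.succ_eq hcov'.1.le
  have hstep (Z : Over Y) : ∃ (Z' : Over Y) (φ : Z ⟶ Z'), W' φ := by
    obtain ⟨P, j, p, hj, hjp, h⟩ := hE.exists_attach S i hi Z.hom
    exact ⟨Over.mk p, Over.homMk j hjp, hj, h⟩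
  choose succ toSucc hsucc using hstep
  obtain ⟨F, hF, ⟨e⟩, hFW⟩ := exists_iteration W' (fun K _ _ _ _ F _ hF => by
    have := hcont K F hF
    have := hE.hasColimit_of_le hWM K (F ⋙ Over.forget Y) (fun j hj => (hF j hj).1)
    infer_instance) succ toSucc hsucc (Over.mk g) J
  replace hFW (j : J) : W' (F.map (homOfLE (Order.le_succ j))) := by
    obtain ⟨Z, ⟨e⟩⟩ := hFW j (not_isMax j)
    exact (W'.arrow_mk_iso_iff e).2 (hsucc Z)
  have := hcont J F (fun j _ => hFW j)
  let G := F ⋙ Over.forget Y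
  have hG : HasColimit G := hE.hasColimit_of_le hWM J G (fun j _ => (hFW j).1)
  let c : Cocone G := { pt := Y, ι := { app := fun j => (F.obj j).hom } }
  let p : colimit G ⟶ Y := colimit.desc G c
  have hp (j : J) : colimit.ι G j ≫ p = (F.obj j).hom := colimit.ι_desc _ _
  refine ⟨colimit G, e.inv.left ≫ colimit.ι G ⊥, p, ?_, ?_, ?_⟩
  · refine W.transfiniteCompositionsOfShape_le J _ ⟨
      { F := G
        isoBot := (Over.forget Y).mapIso e
        incl := (colimit.cocone G).ι
        isColimit := colimit.isColimit G
        fac := rfl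
        map_mem := fun j _ => (hFW j).1 }⟩
  · exact (Category.assoc _ _ _).trans (congr(e.inv.left ≫ $(hp ⊥)).trans (Over.w e.inv))
  · intro k
    obtain ⟨κ', hκ', hsmall⟩ := hA k
    have hpres := hsmall J G (hκ'.trans hcof) (fun j _ => hWM _ (hFW j).1)
    refine ⟨fun {x y} sq => ?_⟩
    -- Smallness of `A k` and `cof J ≥ κ` make `x` factor through a stage `j`; the resulting lifting
    -- problem is solved at stage `succ j`.
    obtain ⟨j, x', hx'⟩ : ∃ (j : J) (x' : A k ⟶ G.obj j), x' ≫ colimit.ι G j = x :=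
      Types.jointly_surjective _
        (isColimitOfPreserves (coyoneda.obj (Opposite.op (A k))) (colimit.isColimit G)) x
    obtain ⟨l, hl, hl'⟩ : ∃ l : B k ⟶ G.obj (Order.succ j),
        i k ≫ l = x' ≫ G.map (homOfLE (Order.le_succ j)) ∧
          l ≫ (F.obj (Order.succ j)).hom = y :=
      (hFW j).2 k x' y (congr(x' ≫ $(hp j)).symm.trans
        ((Category.assoc _ _ _).symm.trans (congr($hx' ≫ p).trans sq.w)))
    refine ⟨⟨⟨l ≫ colimit.ι G (Order.succ j), ?_, ?_⟩⟩⟩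
    · rw [reassoc_of% hl, colimit.w, hx']
    · exact (Category.assoc _ _ _).trans (congr(l ≫ $(hp _)).trans hl')

end IsEfficient

end ExactStructure

end ExactCat

/-! ### Approximations and cotorsion pairs -/

namespace ExactCat.ExactStructure

variable {C : Type u} [Category.{v} C] [Preadditive C] [HasZeroObject C]
  [HasBinaryBiproducts C] {E : ExactStructure C}

open ZeroObject

lemma isConflation_id_zero (X : C) : E.IsConflation (𝟙 X) (0 : X ⟶ (0 : C)) := by
  have : Epi (0 : X ⟶ (0 : C)) := ⟨fun _ _ _ => (isZero_zero C).eq_of_src _ _⟩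
  exact isConflation_of_inflation (E.id_inflation X) (by simp)
    (fun k hk => ⟨0, by simpa using hk.symm⟩)

/-- An object `T` belongs to `S^{⊥₁}` as soon as `T ⟶ 0` has the right lifting property with
respect to the inflations with cokernel in `S`. -/
lemma rightOrth_of_hasLiftingProperty {S : ObjectProperty C} {T : C}
    (h : ∀ ⦃A B : C⦄ (f : A ⟶ B), E.inflationsWithCokernelIn S f →
      HasLiftingProperty f (0 : T ⟶ (0 : C))) : E.rightOrth S T := by
  intro X hX
  rw [ext1Vanishes_iff]
  intro Z i p hip
  have := h i ⟨X, p, hX, hip⟩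
  have sq : CommSq (𝟙 T) i (0 : T ⟶ (0 : C)) 0 := ⟨by simp⟩
  exact ⟨sq.lift, sq.fac_left⟩

lemma exists_extension_of_transfiniteCompositions {S : ObjectProperty C} {A B T : C} {j : A ⟶ B}
    (hj : (E.inflationsWithCokernelIn S).transfiniteCompositions.{v} j) (hT : E.rightOrth S T)
    (f : A ⟶ T) : ∃ g : B ⟶ T, j ≫ g = f := by
  have := transfiniteCompositions_le_llp S j hj (0 : T ⟶ (0 : C))
    ⟨T, 𝟙 T, hT, isConflation_id_zero T⟩
  have sq : CommSq f j (0 : T ⟶ (0 : C)) 0 := ⟨by simp⟩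
  exact ⟨sq.lift, sq.fac_left⟩

namespace IsEfficient

variable (hE : E.IsEfficient)
include hE

/-- The inflations with cokernel in `S` are pushouts of members of a small family of such. -/
lemma exists_generating_family (S : ObjectProperty C) (hS : ObjectProperty.Small.{v} S) :
    ∃ (ι : Type v) (A B : ι → C) (i : ∀ k, A k ⟶ B k),
      (∀ k, E.inflationsWithCokernelIn S (i k)) ∧
      ∀ ⦃X Y : C⦄ (f : X ⟶ Y), E.inflationsWithCokernelIn S f →
        ∃ (k : ι) (a : A k ⟶ X) (b : B k ⟶ Y), IsPushout a (i k) f b := by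
  obtain ⟨I, hI, hIinf, hsh, hcoker⟩ := hE.stronglyHomological S hS
  let φ : Shrink.{v} I.toSet → Arrow C := fun k => ((equivShrink _).symm k).1
  have hφ (k) : I (φ k).hom :=
    (MorphismProperty.arrow_mk_mem_toSet_iff I (φ k).hom).1 ((equivShrink _).symm k).2
  refine ⟨Shrink.{v} I.toSet, fun k => (φ k).left, fun k => (φ k).right, fun k => (φ k).hom,
    fun k => ?_, ?_⟩
  · obtain ⟨X, p, h⟩ := exists_isConflation_of_inflation (hIinf _ (hφ k))
    obtain ⟨X', hX', ⟨e⟩⟩ : S.isoClosure X := hcoker ▸ ⟨_, _, _, p, hφ k, h⟩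
    exact ⟨X', p ≫ e.hom, hX', h.of_iso (Iso.refl _) (Iso.refl _) e (by simp) (by simp)⟩
  · rintro Y Z f ⟨X, q, hX, hf⟩
    -- Strong homologicality gives a morphism of conflations that is the identity on the cokernel,
    -- which `IsConflation.isPushout` turns into a pushout square.
    obtain ⟨A', B', i, p, a, b, hi, hip, hab, hb⟩ :=
      hsh f q (hcoker ▸ ObjectProperty.le_isoClosure _ _ hX) hf
    let k : Shrink.{v} I.toSet :=
      equivShrink _ ⟨Arrow.mk i, (MorphismProperty.arrow_mk_mem_toSet_iff _ _).2 hi⟩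
    have hk : φ k = Arrow.mk i := by simp [φ, k]
    suffices ∀ (g : Arrow C), g = Arrow.mk i →
        ∃ (a : g.left ⟶ Y) (b : g.right ⟶ Z), IsPushout a g.hom f b from ⟨k, this _ hk⟩
    rintro _ rfl
    exact ⟨a, b, hip.isPushout hf hab hb⟩

/-- Every morphism is a transfinite composition of inflations with cokernel in `S` followed by
a morphism having the right lifting property with respect to all such compositions. -/
theorem exists_factorization_llp (S : ObjectProperty C) (hS : ObjectProperty.Small.{v} S)
    {X Y : C} (g : X ⟶ Y) :
    ∃ (P : C) (j : X ⟶ P) (p : P ⟶ Y),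
      (E.inflationsWithCokernelIn S).transfiniteCompositions.{v} j ∧ j ≫ p = g ∧
      ∀ ⦃A B : C⦄ (f : A ⟶ B),
        (E.inflationsWithCokernelIn S).transfiniteCompositions.{v} f →
          HasLiftingProperty f p := by
  obtain ⟨ι, A, B, i, hi, hgen⟩ := hE.exists_generating_family S hS
  obtain ⟨P, j, p, hj, hjp, hp⟩ := hE.exists_factorization S i hi g
  refine ⟨P, j, p, hj, hjp, fun A' B' f hf => ?_⟩
  -- Morphisms with left lifting against `p` are closed under pushouts and transfinite compositions,
  -- so it suffices to lift the generating family.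
  have hle : (E.inflationsWithCokernelIn S).transfiniteCompositions.{v} ≤
      (MorphismProperty.ofHoms (fun _ : Unit => p)).llp := by
    rw [MorphismProperty.transfiniteCompositions_le_iff]
    intro X' Y' f' hf'
    obtain ⟨k, a, b, sq⟩ := hgen f' hf'
    refine MorphismProperty.of_isPushout sq ?_
    rintro _ _ _ ⟨⟩
    exact hp k
  exact hle f hf p ⟨()⟩

lemma isPrecovering_filt (S : ObjectProperty C) (hS : ObjectProperty.Small.{v} S) :
    IsPrecovering (E.filt S) := by
  intro M
  obtain ⟨X, j, p, hj, -, hp⟩ := hE.exists_factorization_llp S hS (0 : (0 : C) ⟶ M)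
  obtain rfl : j = 0 := (isZero_zero C).eq_of_src _ _
  refine ⟨X, p, hj, fun X' f' hX' => ?_⟩
  have := hp _ hX'
  have sq : CommSq (0 : (0 : C) ⟶ X) (0 : (0 : C) ⟶ X') p f' := ⟨by simp⟩
  exact ⟨sq.lift, sq.fac_right⟩

/-- Every object embeds in an object of `S^{⊥₁}` with `S`-filtered cokernel. -/
lemma exists_isConflation_rightOrth_filt (S : ObjectProperty C)
    (hS : ObjectProperty.Small.{v} S) (M : C) :
    ∃ (T X : C) (j : M ⟶ T) (q : T ⟶ X), E.rightOrth S T ∧ E.filt S X ∧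
      (E.inflationsWithCokernelIn S).transfiniteCompositions.{v} j ∧ E.IsConflation j q := by
  obtain ⟨T, j, p, hj, -, hp⟩ := hE.exists_factorization_llp S hS (0 : M ⟶ (0 : C))
  obtain rfl : p = 0 := (isZero_zero C).eq_of_tgt _ _
  obtain ⟨X, q, hjq⟩ := exists_isConflation_of_inflation (hE.transfiniteCompositions_le S _ hj)
  refine ⟨T, X, j, q, rightOrth_of_hasLiftingProperty fun A B f hf =>
    hp f (MorphismProperty.le_transfiniteCompositions _ _ hf), ?_, hj, hjq⟩
  -- The cokernel projection exhibits `0 ⟶ X` as the pushout of `j` along `M ⟶ 0`, so `X` inherits a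
  -- filtration from `j`.
  exact hE.transfiniteCompositions_of_isPushout S
    (hjq.isPushout (isConflation_zero_id X) (a := 0) (b := q) (by simp [hjq.w]) (by simp)) hj

lemma isPreenveloping_rightOrth (S : ObjectProperty C) (hS : ObjectProperty.Small.{v} S) :
    IsPreenveloping (E.rightOrth S) := by
  intro M
  obtain ⟨T, X, j, q, hT, -, hj, -⟩ := hE.exists_isConflation_rightOrth_filt S hS M
  exact ⟨T, j, hT, fun T' f hT' => exists_extension_of_transfiniteCompositions hj hT' f⟩

/-- From a deflation `G ⟶ M` one gets a deflation `P ⟶ M` with kernel in `S^{⊥₁}`, where `P` is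
an extension of an `S`-filtered object by `G`. -/
lemma exists_isConflation_of_deflation (S : ObjectProperty C) (hS : ObjectProperty.Small.{v} S)
    {G M : C} {p : G ⟶ M} (hp : E.deflations p) :
    ∃ (T P X : C) (k : T ⟶ P) (q : P ⟶ M) (j : G ⟶ P) (c : P ⟶ X), E.rightOrth S T ∧
      E.filt S X ∧ (E.inflationsWithCokernelIn S).transfiniteCompositions.{v} j ∧
      E.IsConflation k q ∧ E.IsConflation j c := by
  obtain ⟨K, i, hi⟩ := ExactStructure.exists_isConflation_of_deflation hp
  obtain ⟨T, X, l, m, hT, hX, hl, hlm⟩ := hE.exists_isConflation_rightOrth_filt S hS K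
  -- Salce's trick: the pushout of `K ⟶ G` and `K ⟶ T` lies in a conflation `T ⟶ P ⟶ M` and in a
  -- conflation `G ⟶ P ⟶ X`.
  obtain ⟨P, k, j, sq, -⟩ := E.pushout_inflation i l hi.inflation
  obtain ⟨q, -, hkq⟩ := hi.exists_of_isPushout sq
  obtain ⟨c, -, hjc⟩ := hlm.exists_of_isPushout sq.flip
  exact ⟨T, P, X, k, q, j, c, hT, hX, hE.transfiniteCompositions_of_isPushout S sq.flip hl,
    hkq, hjc⟩

/-- Coproducts of objects of `S` are `S`-filtered. -/
lemma filt_of_isColimit_cofan (S : ObjectProperty C) {ι : Type v} {X : ι → C} {c : Cofan X}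
    (hc : IsColimit c) (hX : ∀ k, S (X k)) : E.filt S c.pt := by
  -- Attaching the morphisms `0 ⟶ X k` to `0` builds the coproduct of the `X k`.
  obtain ⟨P, f, b, hf, h⟩ := exists_isMultiPushout (W := E.inflationsWithCokernelIn S)
    (A := fun _ : ι => (0 : C)) (B := X) (X := (0 : C)) (fun _ => 0) (fun _ => 0)
    (fun _ _ _ i t hi => hasPushout_of_inflation i t (inflationsWithCokernelIn_le S _ hi))
    (hE.hasColimit_of_le (inflationsWithCokernelIn_le S))
    (fun k => ⟨X k, 𝟙 _, hX k, isConflation_zero_id _⟩)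
  obtain ⟨d, -, hd⟩ := h.exists_desc (0 : (0 : C) ⟶ c.pt) (fun k _ => c.inj k) (by simp)
  let d' : c.pt ⟶ P := Cofan.IsColimit.desc hc (fun k => b k (Set.mem_univ k))
  have hd' (k : ι) : c.inj k ≫ d' = b k (Set.mem_univ k) := Cofan.IsColimit.fac hc _ k
  have : IsIso d := ⟨d', h.hom_ext ((isZero_zero C).eq_of_src _ _) (fun k _ => by
    rw [← Category.assoc, hd, hd', Category.comp_id]), Cofan.IsColimit.hom_ext hc _ _ (fun k => by
    rw [← Category.assoc, hd', hd, Category.comp_id])⟩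
  have hfd : f ≫ d = 0 := (isZero_zero C).eq_of_src _ _
  have hf' := MorphismProperty.RespectsIso.postcomp _ d _ hf
  rwa [hfd] at hf'

/-- The other approximation sequence needs no hypothesis on generators or projectives, so only the
one ending in `M` is assumed. -/
lemma isCompleteCotorsionPair (S : ObjectProperty C) (hS : ObjectProperty.Small.{v} S)
    (h : ∀ M : C, ∃ (T X : C) (i : T ⟶ X) (p : X ⟶ M), E.rightOrth S T ∧
      E.leftOrth (E.rightOrth S) X ∧ E.IsConflation i p) :
    E.IsCompleteCotorsionPair (E.leftOrth (E.rightOrth S)) (E.rightOrth S) := by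
  refine ⟨isCotorsionPair_leftOrth_rightOrth S, fun M => ⟨h M, ?_⟩⟩
  obtain ⟨T, X, j, q, hT, hX, -, hjq⟩ := hE.exists_isConflation_rightOrth_filt S hS M
  exact ⟨T, X, j, q, hT, filt_le_leftOrth S _ hX, hjq⟩

lemma exists_isConflation_of_isGenerating (S : ObjectProperty C)
    (hS : ObjectProperty.Small.{v} S) (hG : E.IsGenerating S) (M : C) :
    ∃ (T X : C) (i : T ⟶ X) (p : X ⟶ M), E.rightOrth S T ∧ E.filt S X ∧ E.IsConflation i p := by
  obtain ⟨ι, Y, c, hc, p, hY, hp⟩ := hG M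
  obtain ⟨T, P, X, k, q, j, _, hT, -, hj, hkq, -⟩ :=
    hE.exists_isConflation_of_deflation S hS hp
  refine ⟨T, P, k, q, hT, ?_, hkq⟩
  have := hE.isStableUnderTransfiniteComposition S
  -- The filtration of the coproduct is continued by `j`, which filters the middle term `P`.
  have h := MorphismProperty.comp_mem _ _ _ (hE.filt_of_isColimit_cofan S hc hY) hj
  rwa [zero_comp] at h

lemma exists_isConflation_of_hasEnoughProjectives (S : ObjectProperty C)
    (hS : ObjectProperty.Small.{v} S) (hP : E.HasEnoughProjectives) (M : C) :
    ∃ (T Z : C) (k : T ⟶ Z) (q : Z ⟶ M), E.rightOrth S T ∧ E.IsConflation k q ∧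
      ∃ (P X : C) (i : P ⟶ Z) (p : Z ⟶ X), E.IsProjective P ∧ E.filt S X ∧
        E.IsConflation i p := by
  obtain ⟨P, p, hP, hp⟩ := hP M
  obtain ⟨T, Z, X, k, q, j, c, hT, hX, -, hkq, hjc⟩ :=
    hE.exists_isConflation_of_deflation S hS hp
  exact ⟨T, Z, k, q, hT, hkq, P, X, j, c, hP, hX, hjc⟩

end IsEfficient

end ExactCat.ExactStructure

/-! ### The theorem -/

open ExactCat.ExactStructure in
theorem mainTheorem2 {C : Type u} [Category.{v} C] [Preadditive C] [HasZeroObject C]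
    [HasBinaryBiproducts C] (E : ExactCat.ExactStructure C) (hE : E.IsEfficient)
    (S : ObjectProperty C) (hS : ObjectProperty.Small.{v} S)
    (T : ObjectProperty C) (hT : T = E.rightOrth S) :
    (ExactCat.IsPrecovering (E.filt S) ∧ ExactCat.IsPreenveloping T) ∧
    (E.IsGenerating S →
      E.IsCompleteCotorsionPair (E.leftOrth T) T ∧
      ∀ M : C, E.leftOrth T M ↔ ∃ X : C, E.filt S X ∧ ExactCat.IsSummand M X) ∧
    (E.HasEnoughProjectives →
      E.IsCompleteCotorsionPair (E.leftOrth T) T ∧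
      ∀ M : C, E.leftOrth T M ↔
        ∃ (P Z X : C) (i : P ⟶ Z) (p : Z ⟶ X), E.IsProjective P ∧ E.filt S X ∧
          E.IsConflation i p ∧ ExactCat.IsSummand M Z) := by
  subst hT
  refine ⟨⟨hE.isPrecovering_filt S hS, hE.isPreenveloping_rightOrth S hS⟩, fun hG => ⟨?_, fun M =>
    ⟨fun hM => ?_, ?_⟩⟩, fun hP => ⟨?_, fun M => ⟨fun hM => ?_, ?_⟩⟩⟩
  · refine hE.isCompleteCotorsionPair S hS (fun M => ?_)
    obtain ⟨T, X, i, p, hT, hX, h⟩ := hE.exists_isConflation_of_isGenerating S hS hG M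
    exact ⟨T, X, i, p, hT, filt_le_leftOrth S _ hX, h⟩
  · obtain ⟨T, X, i, p, hT, hX, h⟩ := hE.exists_isConflation_of_isGenerating S hS hG M
    -- The kernel of the approximation lies in `S^{⊥₁}` and `M` is left orthogonal to it, so the
    -- conflation splits and `M` is a summand of the filtered object.
    obtain ⟨s, hs⟩ := (hM T hT).exists_section h
    exact ⟨X, hX, h.isSummand_of_section hs⟩
  · rintro ⟨X, hX, hMX⟩
    exact leftOrth_of_isSummand hMX (filt_le_leftOrth S _ hX)
  · refine hE.isCompleteCotorsionPair S hS (fun M => ?_)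
    obtain ⟨T, Z, k, q, hT, hkq, P, X, i, p, hP, hX, h⟩ :=
      hE.exists_isConflation_of_hasEnoughProjectives S hS hP M
    exact ⟨T, Z, k, q, hT, leftOrth_of_isConflation h (leftOrth_of_isProjective hP)
      (filt_le_leftOrth S _ hX), hkq⟩
  · obtain ⟨T, Z, k, q, hT, hkq, P, X, i, p, hP, hX, h⟩ :=
      hE.exists_isConflation_of_hasEnoughProjectives S hS hP M
    obtain ⟨s, hs⟩ := (hM T hT).exists_section hkq
    exact ⟨P, Z, X, i, p, hP, hX, h, hkq.isSummand_of_section hs⟩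
  · rintro ⟨P, Z, X, i, p, hP, hX, h, hMZ⟩
    exact leftOrth_of_isSummand hMZ (leftOrth_of_isConflation h (leftOrth_of_isProjective hP)
      (filt_le_leftOrth S _ hX))
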